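/- **Setting.** Let $M$ be a smooth finite-dimensional manifold (Hausdorff, $\sigma$-compact, without boundary) and let $\tau : A \to M$ be a smooth affine bundle of finite rank modelled on the vector bundle $V(A)\to M$. Let $A^\dagger \to M$ be the vector bundle whose fibre at $p$ is the space of affine functions $A_p \to \mathbb{R}$, let $\varphi = 1_A \in \mathrm{Sec}(A^\dagger)$ be the section which on every fibre is the constant function $1$, and let $\widehat A = (A^\dagger)^*$ be the vector hull of $A$. We view $A \subset \widehat A$ through $a \mapsto (f \mapsto f(a))$, whose image is the set $\{\iota_\varphi = 1\}$, and $V(A) \subset \widehat A$ through $v \mapsto (f \mapsto f_{\mathsf v}(v))$, where $f_{\mathsf v}$ is the linear part of $f$; the image of $V(A)$ is $\{\iota_\varphi = 0\}$. Here, for a section $\mu$ of a vector bundle, $\iota_\mu$ denotes the corresponding fibrewise linear function on the dual bundle. $\mathrm{Sec}$ denotes smooth sections. A *Lie algebroid* structure on a vector bundle $E\to M$ is a Lie bracket $[\cdot,\cdot]$ on $\mathrm{Sec}(E)$ together with a vector bundle morphism $\rho : E \to TM$ over $\mathrm{id}_M$ such that $[X, fY] = f[X,Y] + \rho(X)(f)\,Y$.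 A *Lie affgebroid* structure on $A$ is a skew-symmetric bi-affine bracket $[\cdot,\cdot] : \mathrm{Sec}(A)\times \mathrm{Sec}(A) \to \mathrm{Sec}(V(A))$ together with a morphism of affine bundles $\gamma : A \to TM$ over $\mathrm{id}_M$ such that, writing $[\alpha,\cdot]^{\mathsf v} : \mathrm{Sec}(V(A)) \to \mathrm{Sec}(V(A))$ for the linear part of $[\alpha, \cdot]$, $$[\alpha_1,[\alpha_2,\alpha_3]]^{\mathsf v} + [\alpha_2,[\alpha_3,\alpha_1]]^{\mathsf v} + [\alpha_3,[\alpha_1,\alpha_2]]^{\mathsf v} = 0, \qquad [\alpha, fX]^{\mathsf v} = f[\alpha,X]^{\mathsf v} + \gamma(\alpha)(f)\,X$$ for all $\alpha,\alpha_i \in \mathrm{Sec}(A)$, $X \in \mathrm{Sec}(V(A))$, $f \in C^\infty(M)$. Let a Lie algebroid structure $([\cdot,\cdot],\rho)$ be given on $\widehat A$. For $\mu \in \mathrm{Sec}(A^\dagger)$ and $X,Y\in \mathrm{Sec}(\widehat A)$ put $$d\mu(X,Y) = \rho(X)\langle \mu, Y\rangle - \rho(Y)\langle \mu, X\rangle -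 \langle \mu, [X,Y]\rangle, \qquad \langle\mathcal L_X\mu, Y\rangle = \rho(X)\langle\mu,Y\rangle - \langle\mu,[X,Y]\rangle .$$ Let $\Lambda$ be the corresponding linear Poisson tensor on the manifold $A^\dagger$ (with projection $\pi$ to $M$), that is, the unique bivector field with $\Lambda(d\iota_X, d\iota_Y) = \iota_{[X,Y]}$, $\Lambda(d\iota_X, d(f\circ\pi)) = \rho(X)(f)\circ\pi$ and $\Lambda(d(f\circ\pi),d(g\circ\pi)) = 0$ for all $X, Y \in \mathrm{Sec}(\widehat A)$ and $f,g\in C^\infty(M)$. The vertical lift $\mathcal V(\varphi)$ is the vector field on $A^\dagger$ whose value at $w$ is the velocity at $t=0$ of $t\mapsto w + t\,\varphi(\pi(w))$. For $X \in \mathrm{Sec}(\widehat A)$ the complete lift $X^c$ is the unique vector field on the manifold $\widehat A$ (with projection $\widehat\pi$ to $M$) such that $X^c(f\circ\widehat\pi) = \rho(X)(f)\circ\widehat\pi$ and $X^c(\iota_\mu) = \iota_{\mathcal L_X\mu}$ for all $f \in C^\infty(M)$ and $\mu\in\mathrm{Sec}(A^\dagger)$. **Theorem.** The following are equivalent: 1.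 the restriction of the bracket of $\widehat A$ to sections of $A$ is a Lie affgebroid bracket on $A$; 2. $[X,Y] \in \mathrm{Sec}(V(A))$ for all $X, Y \in \mathrm{Sec}(A)$; 3. $d\varphi = 0$; 4. the Lie derivative $\mathcal L_{\mathcal V(\varphi)}\Lambda$ of $\Lambda$ along $\mathcal V(\varphi)$ vanishes; 5. for every $X \in \mathrm{Sec}(A)$ the complete lift $X^c$ is tangent to the submanifold $A \subset \widehat A$. -/

import Mathlib

open Bundle Set
open scoped Manifold ContDiff Bundle Topology

set_option linter.unusedSectionVars false

noncomputable section

section AffineBundle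

variable (E : Type*) [NormedAddCommGroup E] [NormedSpace ℝ E]
  {M : Type*} [TopologicalSpace M] [ChartedSpace E M]
  (F : Type*) [NormedAddCommGroup F] [NormedSpace ℝ F]
  (V : M → Type*) [∀ p, AddCommGroup (V p)] [∀ p, Module ℝ (V p)]
  [∀ p, TopologicalSpace (V p)] [TopologicalSpace (TotalSpace F V)]
  [FiberBundle F V] [VectorBundle ℝ F V]
  (A : M → Type*) [∀ p, AddTorsor (V p) (A p)]
  [∀ p, TopologicalSpace (A p)] [TopologicalSpace (TotalSpace F A)] [FiberBundle F A]

/-- A fibre bundle `A → M` whose fibre `A p` is an affine space modelled on the fibre `V p` of a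
vector bundle is a *smooth affine bundle modelled on `V`* if its local trivializations are affine
on fibres, with linear part a smooth change of trivialization of `V`, and its transition maps
`x ↦ T p x + c p` depend smoothly on `p`. -/
class SmoothAffineBundle : Prop where
  exists_coordChange : ∀ (e e' : Trivialization F (π F A))
    [MemTrivializationAtlas e] [MemTrivializationAtlas e'],
    ∃ (T : M → F →L[ℝ] F) (c : M → F),
      ContMDiffOn 𝓘(ℝ, E) 𝓘(ℝ, F →L[ℝ] F) ∞ T (e.baseSet ∩ e'.baseSet) ∧
      ContMDiffOn 𝓘(ℝ, E) 𝓘(ℝ, F) ∞ c (e.baseSet ∩ e'.baseSet) ∧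
      ∀ p ∈ e.baseSet ∩ e'.baseSet, ∀ a : A p, (e' ⟨p, a⟩).2 = T p (e ⟨p, a⟩).2 + c p
  exists_linearPart : ∀ (e : Trivialization F (π F A)) (e' : Trivialization F (π F V))
    [MemTrivializationAtlas e] [MemTrivializationAtlas e'],
    ∃ T : M → F →L[ℝ] F,
      ContMDiffOn 𝓘(ℝ, E) 𝓘(ℝ, F →L[ℝ] F) ∞ T (e.baseSet ∩ e'.baseSet) ∧
      ∀ p ∈ e.baseSet ∩ e'.baseSet, ∀ (v : V p) (a : A p),
        (e ⟨p, v +ᵥ a⟩).2 = T p (e' ⟨p, v⟩).2 + (e ⟨p, a⟩).2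

/-- The fibre at `p` of `A†`: the real affine functions on `A p`. -/
def AffineDual (_E : Type*) {M : Type*} (_F : Type*) (V : M → Type*) [∀ p, AddCommGroup (V p)]
    [∀ p, Module ℝ (V p)] (A : M → Type*) [∀ p, AddTorsor (V p) (A p)] (p : M) : Type _ :=
  A p →ᵃ[ℝ] ℝ

/-- The model fibre of `A†`: the pair `(ℓ, b)` stands for the affine function `x ↦ ℓ x + b`. -/
abbrev AffineDualModel : Type _ := (F →L[ℝ] ℝ) × ℝ

namespace AffineDual

instance (p : M) : AddCommGroup (AffineDual E F V A p) :=
  inferInstanceAs (AddCommGroup (A p →ᵃ[ℝ] ℝ))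

instance (p : M) : Module ℝ (AffineDual E F V A p) :=
  inferInstanceAs (Module ℝ (A p →ᵃ[ℝ] ℝ))

instance (p : M) : FunLike (AffineDual E F V A p) (A p) ℝ :=
  inferInstanceAs (FunLike (A p →ᵃ[ℝ] ℝ) (A p) ℝ)

variable {E F V A}

@[ext] lemma ext {p : M} {f g : AffineDual E F V A p} (h : ∀ a, f a = g a) : f = g :=
  AffineMap.ext h

@[simp] lemma add_apply {p : M} (f g : AffineDual E F V A p) (a : A p) : (f + g) a = f a + g a :=
  rfl

@[simp] lemma smul_apply {p : M} (c : ℝ) (f : AffineDual E F V A p) (a : A p) :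
    (c • f) a = c * f a :=
  rfl

lemma map_vadd {p : M} (f : AffineDual E F V A p) (v : V p) (a : A p) :
    f (v +ᵥ a) = AffineMap.linear (k := ℝ) (V1 := V p) (V2 := ℝ) f v + f a :=
  AffineMap.map_vadd (k := ℝ) (V1 := V p) (V2 := ℝ) f a v

end AffineDual

/-- Affine functions on an affine space `P ≃ F`, `F` a finite-dimensional vector space, as pairs
`(ℓ, b)` with `f a = ℓ (g a) + b`. -/
def affineFunctionCoord {F W P : Type*} [NormedAddCommGroup F] [NormedSpace ℝ F]
    [FiniteDimensional ℝ F] [AddCommGroup W] [Module ℝ W] [AddTorsor W P] (g : P ≃ᵃ[ℝ] F) :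
    (P →ᵃ[ℝ] ℝ) ≃ₗ[ℝ] AffineDualModel F where
  toFun f := (LinearMap.toContinuousLinearMap (f.linear ∘ₗ g.symm.linear.toLinearMap),
    f (g.symm 0))
  map_add' f h := by
    ext x <;> simp
  map_smul' c f := by
    ext x <;> simp
  invFun m := ((m.1 : F →ₗ[ℝ] ℝ).toAffineMap + AffineMap.const ℝ F m.2).comp g.toAffineMap
  left_inv f := by
    ext a
    have h := AffineMap.map_vadd (f.comp g.symm.toAffineMap) 0 (g a)
    simp only [vadd_eq_add, add_zero, AffineMap.comp_apply, AffineEquiv.coe_toAffineMap,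
      AffineEquiv.symm_apply_apply] at h
    exact h.symm
  right_inv m := by
    ext x
    · simp
    · simp

variable [SmoothAffineBundle E F V A]

variable {F A} in
/-- A local trivialization of `A`, restricted to the fibre at `p`, is a bijection onto `F`. -/
def fiberEquiv (e : Trivialization F (π F A)) (p : M) (hp : p ∈ e.baseSet) : A p ≃ F :=
  Equiv.ofBijective (fun a => (e ⟨p, a⟩).2) <| by
    constructor
    · intro a b h
      have h1 : e ⟨p, a⟩ = e ⟨p, b⟩ :=
        Prod.ext (((e.coe_fst' (x := ⟨p, a⟩) hp)).trans (e.coe_fst' (x := ⟨p, b⟩) hp).symm) h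
      have := e.injOn (e.mem_source.2 hp) (e.mem_source.2 hp) h1
      simpa using this
    · intro x
      have h2 : (e.toOpenPartialHomeomorph.symm (p, x)).proj = p := e.proj_symm_apply' hp
      have h3 : e (e.toOpenPartialHomeomorph.symm (p, x)) = (p, x) := e.apply_symm_apply' hp
      generalize e.toOpenPartialHomeomorph.symm (p, x) = z at h2 h3
      obtain ⟨q, a⟩ := z
      obtain rfl : q = p := h2
      exact ⟨a, by simp only [h3]⟩

variable {F A} in
@[simp] lemma fiberEquiv_apply (e : Trivialization F (π F A)) (p : M) (hp : p ∈ e.baseSet)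
    (a : A p) : fiberEquiv e p hp a = (e ⟨p, a⟩).2 := rfl

variable {F A} in
/-- A local trivialization of the affine bundle `A`, restricted to the fibre at `p`, is an affine
isomorphism onto `F`. -/
def fiberAffineEquiv (e : Trivialization F (π F A)) [MemTrivializationAtlas e] (p : M)
    (hp : p ∈ e.baseSet) : A p ≃ᵃ[ℝ] F :=
  AffineEquiv.ofBijective (φ := AffineMap.mk (fun a => (e ⟨p, a⟩).2)
    ((((SmoothAffineBundle.exists_linearPart (E := E) (V := V) e
        (trivializationAt F V p)).choose p : F →L[ℝ] F) : F →ₗ[ℝ] F) ∘ₗ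
      ((trivializationAt F V p).continuousLinearEquivAt ℝ p
        (mem_baseSet_trivializationAt F V p)).toLinearEquiv.toLinearMap)
    (fun a v => by
      have h := (SmoothAffineBundle.exists_linearPart (E := E) (V := V) e
        (trivializationAt F V p)).choose_spec.2 p ⟨hp, mem_baseSet_trivializationAt F V p⟩ v a
      simpa using h)) (fiberEquiv e p hp).bijective

@[simp] lemma fiberAffineEquiv_apply (e : Trivialization F (π F A)) [MemTrivializationAtlas e]
    (p : M) (hp : p ∈ e.baseSet) (a : A p) : fiberAffineEquiv E V e p hp a = (e ⟨p, a⟩).2 := rfl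

namespace AffineDual

variable [FiniteDimensional ℝ F]

variable {F A} in
/-- The coordinates `(ℓ, b)` of an affine function on `A p` in a local trivialization of `A`. -/
def coordEquiv (e : Trivialization F (π F A)) [MemTrivializationAtlas e] (p : M)
    (hp : p ∈ e.baseSet) : AffineDual E F V A p ≃ₗ[ℝ] AffineDualModel F :=
  affineFunctionCoord (fiberAffineEquiv E V e p hp)

lemma coordEquiv_symm_apply (e : Trivialization F (π F A)) [MemTrivializationAtlas e] (p : M)
    (hp : p ∈ e.baseSet) (m : AffineDualModel F) (a : A p) :
    (coordEquiv E V e p hp).symm m a = m.1 (e ⟨p, a⟩).2 + m.2 := rfl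

lemma coordEquiv_apply (e : Trivialization F (π F A)) [MemTrivializationAtlas e] (p : M)
    (hp : p ∈ e.baseSet) (f : AffineDual E F V A p) (a : A p) :
    f a = (coordEquiv E V e p hp f).1 (e ⟨p, a⟩).2 + (coordEquiv E V e p hp f).2 := by
  rw [← coordEquiv_symm_apply E F V A e p hp, LinearEquiv.symm_apply_apply]

lemma coordEquiv_eq_iff (e : Trivialization F (π F A)) [MemTrivializationAtlas e] (p : M)
    (hp : p ∈ e.baseSet) (f : AffineDual E F V A p) (m : AffineDualModel F) :
    coordEquiv E V e p hp f = m ↔ ∀ a : A p, f a = m.1 (e ⟨p, a⟩).2 + m.2 := by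
  rw [← LinearEquiv.eq_symm_apply]
  exact ⟨fun h a => by rw [h, coordEquiv_symm_apply], fun h => AffineDual.ext h⟩

open Classical in
variable {F A} in
/-- The local trivialization of `A†` induced by a local trivialization of `A`. -/
def pretrivialization (e : Trivialization F (π F A)) [MemTrivializationAtlas e] :
    Pretrivialization (AffineDualModel F) (π (AffineDualModel F) (AffineDual E F V A)) where
  toFun z := (z.1, if h : z.1 ∈ e.baseSet then coordEquiv E V e z.1 h z.2 else 0)
  invFun y := ⟨y.1, if h : y.1 ∈ e.baseSet then (coordEquiv E V e y.1 h).symm y.2 else 0⟩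
  source := π (AffineDualModel F) (AffineDual E F V A) ⁻¹' e.baseSet
  target := e.baseSet ×ˢ univ
  map_source' _ h := ⟨h, mem_univ _⟩
  map_target' _ h := h.1
  left_inv' := by
    rintro ⟨p, f⟩ (h : p ∈ e.baseSet)
    simp [h]
  right_inv' := by
    rintro ⟨p, m⟩ ⟨h, -⟩
    replace h : p ∈ e.baseSet := h
    simp [h]
  open_target := e.open_baseSet.prod isOpen_univ
  baseSet := e.baseSet
  open_baseSet := e.open_baseSet
  source_eq := rfl
  target_eq := rfl
  proj_toFun _ _ := rfl

lemma pretrivialization_apply (e : Trivialization F (π F A)) [MemTrivializationAtlas e] {p : M}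
    (hp : p ∈ e.baseSet) (f : AffineDual E F V A p) :
    pretrivialization E V e ⟨p, f⟩ = (p, coordEquiv E V e p hp f) := by
  change (p, _) = _
  simp [hp]

lemma pretrivialization_symm (e : Trivialization F (π F A)) [MemTrivializationAtlas e] {p : M}
    (hp : p ∈ e.baseSet) (m : AffineDualModel F) :
    (pretrivialization E V e).symm p m = (coordEquiv E V e p hp).symm m := by
  have h := (pretrivialization E V e).mk_symm (b := p) hp m
  have h' : (pretrivialization E V e).toPartialEquiv.symm (p, m) =
      ⟨p, (coordEquiv E V e p hp).symm m⟩ := by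
    change TotalSpace.mk p _ = _
    simp [hp]
  exact TotalSpace.mk_inj.1 (h.trans h')

/-- The topology of the fibre of `A†` is that of the finite-dimensional space
`(F →L[ℝ] ℝ) × ℝ` of coordinates. -/
instance (p : M) : TopologicalSpace (AffineDual E F V A p) :=
  TopologicalSpace.induced
    (coordEquiv E V (trivializationAt F A p) p (mem_baseSet_trivializationAt F A p)) inferInstance

lemma isInducing_coordEquiv (p : M) : Topology.IsInducing
    (coordEquiv E V (trivializationAt F A p) p (mem_baseSet_trivializationAt F A p)) := ⟨rfl⟩

instance (p : M) : IsTopologicalAddGroup (AffineDual E F V A p) :=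
  topologicalAddGroup_induced
    (coordEquiv E V (trivializationAt F A p) p (mem_baseSet_trivializationAt F A p))

instance (p : M) : ContinuousSMul ℝ (AffineDual E F V A p) :=
  continuousSMul_induced
    (coordEquiv E V (trivializationAt F A p) p
      (mem_baseSet_trivializationAt F A p)).toLinearMap

instance (p : M) : T2Space (AffineDual E F V A p) :=
  (Topology.IsEmbedding.mk (isInducing_coordEquiv E F V A p)
    (LinearEquiv.injective _)).t2Space

instance (p : M) : FiniteDimensional ℝ (AffineDual E F V A p) :=
  LinearEquiv.finiteDimensional
    (coordEquiv E V (trivializationAt F A p) p (mem_baseSet_trivializationAt F A p)).symm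

lemma exists_contMDiffOn_coordChange (e e' : Trivialization F (π F A)) [MemTrivializationAtlas e]
    [MemTrivializationAtlas e'] :
    ∃ f : M → AffineDualModel F →L[ℝ] AffineDualModel F,
      ContMDiffOn 𝓘(ℝ, E) 𝓘(ℝ, AffineDualModel F →L[ℝ] AffineDualModel F) ∞ f
        (e.baseSet ∩ e'.baseSet) ∧
      ∀ p ∈ e.baseSet ∩ e'.baseSet, ∀ m : AffineDualModel F,
        f p m = (pretrivialization E V e' ⟨p, (pretrivialization E V e).symm p m⟩).2 := by
  obtain ⟨T, c, hT, hc, h⟩ :=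
    SmoothAffineBundle.exists_coordChange (E := E) (V := V) (A := A) e' e
  rw [inter_comm] at hT hc
  refine ⟨fun p => ContinuousLinearMap.inl ℝ (F →L[ℝ] ℝ) ℝ ∘L
      ((ContinuousLinearMap.compL ℝ F F ℝ).flip (T p) ∘L ContinuousLinearMap.fst ℝ _ _) +
      (ContinuousLinearMap.inr ℝ (F →L[ℝ] ℝ) ℝ ∘L
        (ContinuousLinearMap.apply ℝ ℝ (c p) ∘L ContinuousLinearMap.fst ℝ _ _) +
       ContinuousLinearMap.inr ℝ (F →L[ℝ] ℝ) ℝ ∘L ContinuousLinearMap.snd ℝ _ _), ?_, ?_⟩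
  · have h1 : ContMDiffOn 𝓘(ℝ, E) 𝓘(ℝ, (F →L[ℝ] ℝ) →L[ℝ] (F →L[ℝ] ℝ)) ∞
        (fun p => (ContinuousLinearMap.compL ℝ F F ℝ).flip (T p)) (e.baseSet ∩ e'.baseSet) :=
      (ContinuousLinearMap.contMDiff _).comp_contMDiffOn hT
    have h2 : ContMDiffOn 𝓘(ℝ, E) 𝓘(ℝ, (F →L[ℝ] ℝ) →L[ℝ] ℝ) ∞
        (fun p => ContinuousLinearMap.apply ℝ ℝ (c p)) (e.baseSet ∩ e'.baseSet) := by
      have hA : ContMDiff 𝓘(ℝ, F) 𝓘(ℝ, (F →L[ℝ] ℝ) →L[ℝ] ℝ) ∞ fun x : F =>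
          (ContinuousLinearMap.apply ℝ ℝ x : (F →L[ℝ] ℝ) →L[ℝ] ℝ) := by
        rw [contMDiff_iff_contDiff]
        exact ContinuousLinearMap.contDiff _
      exact hA.comp_contMDiffOn hc
    exact (contMDiffOn_const.clm_comp (h1.clm_comp contMDiffOn_const)).add
      ((contMDiffOn_const.clm_comp (h2.clm_comp contMDiffOn_const)).add contMDiffOn_const)
  · intro p hp m
    rw [pretrivialization_symm E F V A e hp.1, pretrivialization_apply E F V A e' hp.2]
    symm
    rw [coordEquiv_eq_iff]
    intro a
    rw [coordEquiv_symm_apply, h p hp.symm a]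
    simp [add_assoc]

/-- `A†` as a vector bundle. -/
def prebundle : VectorPrebundle ℝ (AffineDualModel F) (AffineDual E F V A) where
  pretrivializationAtlas := {t | ∃ (e : Trivialization F (π F A)) (_ : MemTrivializationAtlas e),
    t = pretrivialization E V e}
  pretrivialization_linear' := by
    rintro _ ⟨e, he, rfl⟩
    refine ⟨fun p hp => ?_⟩
    constructor
    · intro f g
      simp [pretrivialization_apply E F V A e hp]
    · intro r f
      simp [pretrivialization_apply E F V A e hp]
  pretrivializationAt p := pretrivialization E V (trivializationAt F A p)
  mem_base_pretrivializationAt p := mem_baseSet_trivializationAt F A p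
  pretrivialization_mem_atlas p := ⟨trivializationAt F A p, inferInstance, rfl⟩
  exists_coordChange := by
    rintro _ ⟨e, he, rfl⟩ _ ⟨e', he', rfl⟩
    obtain ⟨f, hf, h⟩ := exists_contMDiffOn_coordChange E F V A e e'
    exact ⟨f, hf.continuousOn, h⟩
  totalSpaceMk_isInducing p := by
    have h : (pretrivialization E V (trivializationAt F A p) ∘ TotalSpace.mk p) =
        (fun m => (p, m)) ∘
          coordEquiv E V (trivializationAt F A p) p (mem_baseSet_trivializationAt F A p) := by
      funext f
      exact pretrivialization_apply E F V A _ (mem_baseSet_trivializationAt F A p) f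
    rw [h]
    exact (isInducing_prodMkRight p).comp (isInducing_coordEquiv E F V A p)

instance : TopologicalSpace (TotalSpace (AffineDualModel F) (AffineDual E F V A)) :=
  (prebundle E F V A).totalSpaceTopology

instance : FiberBundle (AffineDualModel F) (AffineDual E F V A) :=
  (prebundle E F V A).toFiberBundle

instance : VectorBundle ℝ (AffineDualModel F) (AffineDual E F V A) :=
  (prebundle E F V A).toVectorBundle

instance : (prebundle E F V A).IsContMDiff 𝓘(ℝ, E) ∞ where
  exists_contMDiffCoordChange := by
    rintro _ ⟨e, he, rfl⟩ _ ⟨e', he', rfl⟩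
    obtain ⟨f, hf, h⟩ := exists_contMDiffOn_coordChange E F V A e e'
    exact ⟨f, hf, h⟩

instance : ContMDiffVectorBundle ∞ (AffineDualModel F) (AffineDual E F V A) 𝓘(ℝ, E) :=
  (prebundle E F V A).contMDiffVectorBundle 𝓘(ℝ, E)

lemma trivializationAt_apply {p q : M} (hq : q ∈ (trivializationAt F A p).baseSet)
    (f : AffineDual E F V A q) :
    trivializationAt (AffineDualModel F) (AffineDual E F V A) p ⟨q, f⟩ =
      (q, coordEquiv E V (trivializationAt F A p) q hq f) :=
  pretrivialization_apply E F V A _ hq f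

end AffineDual

end AffineBundle

section VectorBundle

variable (E : Type*) [NormedAddCommGroup E] [NormedSpace ℝ E]
  {M : Type*} [TopologicalSpace M] [ChartedSpace E M]
  (F : Type*) [NormedAddCommGroup F] [NormedSpace ℝ F]
  (V : M → Type*) [∀ p, TopologicalSpace (V p)] [TopologicalSpace (TotalSpace F V)]
  [FiberBundle F V]

/-- `Sec(V)`: the smooth sections of the bundle `V → M`. -/
abbrev Sec : Type _ := ContMDiffSection 𝓘(ℝ, E) F ∞ V

variable [∀ p, AddCommGroup (V p)] [∀ p, Module ℝ (V p)] [VectorBundle ℝ F V]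

variable {E F V} in
/-- The product of a smooth function and a smooth section. -/
def Sec.fsmul (f : C^∞⟮𝓘(ℝ, E), M; ℝ⟯) (X : Sec E F V) : Sec E F V :=
  ⟨fun p => f p • X p, f.contMDiff.smul_section X.contMDiff⟩

/-- The differential at `x` of a real function on a manifold, as a covector. -/
def differential {B H N : Type*} [NormedAddCommGroup B] [NormedSpace ℝ B] [TopologicalSpace H]
    (I : ModelWithCorners ℝ B H) [TopologicalSpace N] [ChartedSpace H N] (f : N → ℝ) (x : N) :
    TangentSpace I x →L[ℝ] ℝ :=
  mfderiv I 𝓘(ℝ, ℝ) f x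

/-- A Lie algebroid structure on the vector bundle `V → M`: a Lie bracket on `Sec(V)` and a
vector bundle morphism `anchor : V → TM` satisfying the Leibniz rule. -/
structure LieAlgebroid [IsManifold 𝓘(ℝ, E) 1 M] where
  bracket : Sec E F V →ₗ[ℝ] Sec E F V →ₗ[ℝ] Sec E F V
  bracket_skew : ∀ X Y, bracket X Y = -bracket Y X
  jacobi : ∀ X Y Z,
    bracket X (bracket Y Z) + bracket Y (bracket Z X) + bracket Z (bracket X Y) = 0
  anchor : ∀ p, V p →ₗ[ℝ] TangentSpace 𝓘(ℝ, E) p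
  contMDiff_anchor : ContMDiff (𝓘(ℝ, E).prod 𝓘(ℝ, F)) 𝓘(ℝ, E).tangent ∞
    (fun z : TotalSpace F V => (⟨z.1, anchor z.1 z.2⟩ : TangentBundle 𝓘(ℝ, E) M))
  leibniz : ∀ (X : Sec E F V) (f : C^∞⟮𝓘(ℝ, E), M; ℝ⟯) (Y : Sec E F V) (p : M),
    bracket X (Y.fsmul f) p =
      f p • bracket X Y p + differential 𝓘(ℝ, E) f p (anchor p (X p)) • Y p

/-- The dual vector bundle. -/
abbrev DualBundle : M → Type _ := fun p => V p →L[ℝ] Bundle.Trivial M ℝ p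

end VectorBundle

section Lifts

variable {E : Type*} [NormedAddCommGroup E] [NormedSpace ℝ E]
  {M : Type*} [TopologicalSpace M] [ChartedSpace E M] [IsManifold 𝓘(ℝ, E) 1 M]
  {F : Type*} [NormedAddCommGroup F] [NormedSpace ℝ F]
  {W : M → Type*} [∀ p, AddCommGroup (W p)] [∀ p, Module ℝ (W p)]
  [∀ p, TopologicalSpace (W p)] [TopologicalSpace (TotalSpace F W)]
  [FiberBundle F W] [VectorBundle ℝ F W]

/-- The linear function `ι_X` on `W` defined by a section `X` of `W*`. -/
def linearFun (X : Sec E (F →L[ℝ] ℝ) (DualBundle W)) (w : TotalSpace F W) : ℝ := X w.1 w.2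

/-- The linear function `ι_μ` on `W*` defined by a section `μ` of `W`. -/
def linearFunDual (μ : Sec E F W) (e : TotalSpace (F →L[ℝ] ℝ) (DualBundle W)) : ℝ := e.2 (μ e.1)

/-- The pairing `⟨μ, X⟩` of sections of `W` and `W*`. -/
def pairing (μ : Sec E F W) (X : Sec E (F →L[ℝ] ℝ) (DualBundle W)) (p : M) : ℝ := X p (μ p)

/-- The vertical lift of a section `μ` of `W`: the vector field on `W` whose value at `w` is the
velocity at `t = 0` of the curve `t ↦ w + t μ`. -/
def verticalLift (μ : Sec E F W) (w : TotalSpace F W) :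
    TangentSpace (𝓘(ℝ, E).prod 𝓘(ℝ, F)) w :=
  mfderiv 𝓘(ℝ, ℝ) (𝓘(ℝ, E).prod 𝓘(ℝ, F))
    (fun t : ℝ => (⟨w.1, w.2 + t • μ w.1⟩ : TotalSpace F W)) 0 (1 : ℝ)

variable (L : LieAlgebroid E (F →L[ℝ] ℝ) (DualBundle W))

/-- The Lie algebroid exterior derivative of the 1-form `μ`, a section of `W = (W*)*`. -/
def extDeriv₁ (μ : Sec E F W) (X Y : Sec E (F →L[ℝ] ℝ) (DualBundle W)) (p : M) : ℝ :=
  differential 𝓘(ℝ, E) (pairing μ Y) p (L.anchor p (X p)) -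
    differential 𝓘(ℝ, E) (pairing μ X) p (L.anchor p (Y p)) - pairing μ (L.bracket X Y) p

end Lifts

section AffineSections

variable {E : Type*} [NormedAddCommGroup E] [NormedSpace ℝ E]
  {M : Type*} [TopologicalSpace M] [ChartedSpace E M]
  {F : Type*} [NormedAddCommGroup F] [NormedSpace ℝ F]
  {V : M → Type*} [∀ p, AddCommGroup (V p)] [∀ p, Module ℝ (V p)]
  [∀ p, TopologicalSpace (V p)] [TopologicalSpace (TotalSpace F V)]
  [FiberBundle F V] [VectorBundle ℝ F V]
  {A : M → Type*} [∀ p, AddTorsor (V p) (A p)]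
  [∀ p, TopologicalSpace (A p)] [TopologicalSpace (TotalSpace F A)] [FiberBundle F A]
  [SmoothAffineBundle E F V A]

/-- Translation of a section of the affine bundle `A` by a section of its model bundle `V`. -/
instance : VAdd (Sec E F V) (Sec E F A) where
  vadd X α := ⟨fun p => X p +ᵥ α p, by
    intro p₀
    rw [contMDiffAt_section]
    obtain ⟨T, hT, h⟩ := SmoothAffineBundle.exists_linearPart (E := E)
      (trivializationAt F A p₀) (trivializationAt F V p₀)
    have hs : (trivializationAt F A p₀).baseSet ∩ (trivializationAt F V p₀).baseSet ∈ 𝓝 p₀ :=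
      Filter.inter_mem
        ((trivializationAt F A p₀).open_baseSet.mem_nhds (mem_baseSet_trivializationAt F A p₀))
        ((trivializationAt F V p₀).open_baseSet.mem_nhds (mem_baseSet_trivializationAt F V p₀))
    have hX := (contMDiffAt_section (n := ∞) p₀).1 (X.contMDiff p₀)
    have hα := (contMDiffAt_section (n := ∞) p₀).1 (α.contMDiff p₀)
    refine (((hT.contMDiffAt hs).clm_apply hX).add hα).congr_of_eventuallyEq ?_
    filter_upwards [hs] with p hp using h p hp (X p) (α p)⟩

@[simp] lemma Sec.vadd_apply (X : Sec E F V) (α : Sec E F A) (p : M) : (X +ᵥ α) p = X p +ᵥ α p :=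
  rfl

variable (E F V A) in
/-- A Lie affgebroid structure on the affine bundle `A` modelled on `V`. For `α ∈ Sec(A)`, the map
`bracket α` is affine with linear part `linPart α`, and `anchor` is a morphism of affine bundles
from `A` to `TM`. -/
structure LieAffgebroid [IsManifold 𝓘(ℝ, E) 1 M] where
  bracket : Sec E F A → Sec E F A → Sec E F V
  linPart : Sec E F A → Sec E F V →ₗ[ℝ] Sec E F V
  bracket_vadd : ∀ α X β, bracket α (X +ᵥ β) = linPart α X + bracket α β
  bracket_skew : ∀ α β, bracket α β = -bracket β α
  jacobi : ∀ α₁ α₂ α₃, linPart α₁ (bracket α₂ α₃) + linPart α₂ (bracket α₃ α₁) +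
    linPart α₃ (bracket α₁ α₂) = 0
  anchor : ∀ p, A p →ᵃ[ℝ] TangentSpace 𝓘(ℝ, E) p
  contMDiff_anchor : ContMDiff (𝓘(ℝ, E).prod 𝓘(ℝ, F)) 𝓘(ℝ, E).tangent ∞
    (fun z : TotalSpace F A => (⟨z.1, anchor z.1 z.2⟩ : TangentBundle 𝓘(ℝ, E) M))
  leibniz : ∀ (α : Sec E F A) (f : C^∞⟮𝓘(ℝ, E), M; ℝ⟯) (X : Sec E F V) (p : M),
    linPart α (X.fsmul f) p =
      f p • linPart α X p + differential 𝓘(ℝ, E) f p (anchor p (α p)) • X p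

variable [FiniteDimensional ℝ F]

variable (E F V A) in
/-- The vector hull `Â = (A†)*`. -/
abbrev VectorHull : M → Type _ := DualBundle (AffineDual E F V A)

variable (F) in
/-- The model fibre of `Â`. -/
abbrev VectorHullModel : Type _ := AffineDualModel F →L[ℝ] ℝ

variable (E F V A) in
/-- The constant affine function `1` on `A p`. -/
def AffineDual.one (p : M) : AffineDual E F V A p := AffineMap.const ℝ (A p) (1 : ℝ)

variable (E F V A) in
/-- The section `1_A` of `A†`: the constant function `1` on every fibre. -/
def oneSection : Sec E (AffineDualModel F) (AffineDual E F V A) :=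
  ⟨fun p => AffineDual.one E F V A p, by
    intro p₀
    rw [contMDiffAt_section]
    refine (contMDiffAt_const (c := ((0, 1) : AffineDualModel F))).congr_of_eventuallyEq ?_
    filter_upwards [(trivializationAt F A p₀).open_baseSet.mem_nhds
      (mem_baseSet_trivializationAt F A p₀)] with p hp
    rw [AffineDual.trivializationAt_apply E F V A hp]
    refine (AffineDual.coordEquiv_eq_iff E F V A _ p hp _ _).2 fun a => ?_
    simp only [_root_.zero_apply, zero_add]
    rfl⟩

variable (E F V) in
/-- The embedding `A ↪ Â` on fibres: a point is sent to the evaluation at it. -/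
def hullPoint {p : M} (a : A p) : VectorHull E F V A p :=
  LinearMap.toContinuousLinearMap
    { toFun := fun f : AffineDual E F V A p => f a
      map_add' := fun _ _ => rfl
      map_smul' := fun _ _ => rfl }

variable (E F A) in
/-- The embedding `V(A) ↪ Â` on fibres: a vector is sent to `f ↦ f_v(v)`, where `f_v` is the
linear part of the affine function `f`. -/
def hullVector {p : M} (v : V p) : VectorHull E F V A p :=
  LinearMap.toContinuousLinearMap
    { toFun := fun f : AffineDual E F V A p => AffineMap.linear (k := ℝ) (V1 := V p) (V2 := ℝ) f v
      map_add' := fun _ _ => rfl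
      map_smul' := fun _ _ => rfl }

variable (E F V A) in
/-- The embedding `A ↪ Â` as a map between the total spaces. -/
def hullMap (a : TotalSpace F A) : TotalSpace (VectorHullModel F) (VectorHull E F V A) :=
  ⟨a.1, hullPoint E F V a.2⟩

/-- A section of `A` as a section of `Â`. -/
def hullSection (α : Sec E F A) : Sec E (VectorHullModel F) (VectorHull E F V A) :=
  ⟨fun p => hullPoint E F V (α p), by
    intro p₀
    rw [contMDiffAt_section]
    have hα := (contMDiffAt_section (n := ∞) p₀).1 (α.contMDiff p₀)
    have hA : ContMDiff 𝓘(ℝ, F) 𝓘(ℝ, (F →L[ℝ] ℝ) →L[ℝ] ℝ) ∞ fun x : F =>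
        (ContinuousLinearMap.apply ℝ ℝ x : (F →L[ℝ] ℝ) →L[ℝ] ℝ) := by
      rw [contMDiff_iff_contDiff]
      exact ContinuousLinearMap.contDiff _
    have h : ContMDiffAt 𝓘(ℝ, E) 𝓘(ℝ, VectorHullModel F) ∞
        (fun p => (ContinuousLinearMap.apply ℝ ℝ (trivializationAt F A p₀ ⟨p, α p⟩).2 :
            (F →L[ℝ] ℝ) →L[ℝ] ℝ) ∘L ContinuousLinearMap.fst ℝ _ _ +
          ContinuousLinearMap.snd ℝ (F →L[ℝ] ℝ) ℝ) p₀ :=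
      ((hA.contMDiffAt.comp p₀ hα).clm_comp contMDiffAt_const).add contMDiffAt_const
    refine h.congr_of_eventuallyEq ?_
    filter_upwards [(trivializationAt F A p₀).open_baseSet.mem_nhds
      (mem_baseSet_trivializationAt F A p₀)] with p hp
    refine ContinuousLinearMap.ext fun m => ?_
    have hp' : p ∈ (trivializationAt (AffineDualModel F) (AffineDual E F V A) p₀).baseSet := hp
    rw [hom_trivializationAt_apply]
    have h1 : (trivializationAt (AffineDualModel F) (AffineDual E F V A) p₀).symm p m =
        (AffineDual.coordEquiv E V (trivializationAt F A p₀) p hp).symm m :=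
      AffineDual.pretrivialization_symm E F V A (trivializationAt F A p₀) hp m
    have h2 := AffineDual.coordEquiv_symm_apply E F V A (trivializationAt F A p₀) p hp m (α p)
    simp only [ContinuousLinearMap.inCoordinates]
    change (trivializationAt ℝ (Bundle.Trivial M ℝ) p₀).linearMapAt ℝ p (hullPoint E F V (α p)
      ((trivializationAt (AffineDualModel F) (AffineDual E F V A) p₀).symmL ℝ p m)) = _
    rw [Trivialization.symmL_apply _ hp', h1,
      Trivialization.coe_linearMapAt_of_mem _ (mem_univ p)]
    exact h2⟩
end AffineSections

section LocalFrames

variable {E : Type*} [NormedAddCommGroup E] [NormedSpace ℝ E] [FiniteDimensional ℝ E]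
  {M : Type*} [TopologicalSpace M] [ChartedSpace E M] [IsManifold 𝓘(ℝ, E) ∞ M] [T2Space M]
  {F : Type*} [NormedAddCommGroup F] [NormedSpace ℝ F] [FiniteDimensional ℝ F]
  {V : M → Type*} [∀ p, AddCommGroup (V p)] [∀ p, Module ℝ (V p)]
  [∀ p, TopologicalSpace (V p)] [TopologicalSpace (TotalSpace F V)]
  [FiberBundle F V] [VectorBundle ℝ F V] [ContMDiffVectorBundle ∞ F V 𝓘(ℝ, E)]

/-- The local representative of a section near `p`. -/
def Sec.coord (X : Sec E F V) (p q : M) : F := (trivializationAt F V p ⟨q, X q⟩).2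

lemma Sec.contMDiffOn_coord (X : Sec E F V) (p : M) :
    ContMDiffOn 𝓘(ℝ, E) 𝓘(ℝ, F) ∞ (X.coord p) (trivializationAt F V p).baseSet :=
  ((trivializationAt F V p).contMDiffOn_section_baseSet_iff).1 X.contMDiff.contMDiffOn

lemma Sec.mdifferentiableAt_coord (X : Sec E F V) (p : M) :
    MDifferentiableAt 𝓘(ℝ, E) 𝓘(ℝ, F) (X.coord p) p :=
  ((X.contMDiffOn_coord p).contMDiffAt ((trivializationAt F V p).open_baseSet.mem_nhds
    (mem_baseSet_trivializationAt F V p))).mdifferentiableAt (by simp)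

lemma exists_bump (p : M) (u : Set M) (hu : u ∈ 𝓝 p) : ∃ b : C^∞⟮𝓘(ℝ, E), M; ℝ⟯,
    b =ᶠ[𝓝 p] 1 ∧ tsupport b ⊆ u := by
  obtain ⟨b, hb⟩ := ((SmoothBumpFunction.nhds_basis_support (I := 𝓘(ℝ, E)) hu).ex_mem)
  exact ⟨⟨b, b.contMDiff⟩, b.eventuallyEq_one, hb⟩

lemma hasMFDerivAt_bundle_proj (z : TotalSpace F V) :
    HasMFDerivAt (𝓘(ℝ, E).prod 𝓘(ℝ, F)) 𝓘(ℝ, E) (π F V) z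
      (ContinuousLinearMap.fst ℝ E F : E × F →L[ℝ] E) := by
  refine ⟨(FiberBundle.continuous_proj F V).continuousAt, ?_⟩
  have key : ∀ y ∈ (extChartAt (𝓘(ℝ, E).prod 𝓘(ℝ, F)) z).target,
      writtenInExtChartAt (𝓘(ℝ, E).prod 𝓘(ℝ, F)) 𝓘(ℝ, E) z (π F V) y = y.1 := by
    intro y hy
    rw [FiberBundle.extChartAt_target] at hy
    have h1 : ((extChartAt (𝓘(ℝ, E).prod 𝓘(ℝ, F)) z).symm y).proj =
        (extChartAt 𝓘(ℝ, E) z.proj).symm y.1 := by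
      rw [FiberBundle.extChartAt]
      exact (trivializationAt F V z.proj).proj_symm_apply' hy.1.2
    rw [writtenInExtChartAt, Function.comp_apply, Function.comp_apply, h1]
    exact (extChartAt 𝓘(ℝ, E) z.proj).right_inv hy.1.1
  refine (hasFDerivAt_fst (p := extChartAt (𝓘(ℝ, E).prod 𝓘(ℝ, F)) z z)).hasFDerivWithinAt
    |>.congr_of_eventuallyEq ?_ (key _ (mem_extChartAt_target z))
  filter_upwards [extChartAt_target_mem_nhdsWithin (I := 𝓘(ℝ, E).prod 𝓘(ℝ, F)) z] with y hy
    using key y hy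

lemma hasMFDerivAt_bundle_snd (z : TotalSpace F V) :
    HasMFDerivAt (𝓘(ℝ, E).prod 𝓘(ℝ, F)) 𝓘(ℝ, F) (fun y => (trivializationAt F V z.1 y).2) z
      (ContinuousLinearMap.snd ℝ E F : E × F →L[ℝ] F) := by
  refine ⟨?_, ?_⟩
  · exact continuous_snd.continuousAt.comp ((trivializationAt F V z.1).continuousAt
      ((trivializationAt F V z.1).mem_source.2 (mem_baseSet_trivializationAt F V z.1)))
  have key : ∀ y ∈ (extChartAt (𝓘(ℝ, E).prod 𝓘(ℝ, F)) z).target,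
      writtenInExtChartAt (𝓘(ℝ, E).prod 𝓘(ℝ, F)) 𝓘(ℝ, F) z
        (fun y => (trivializationAt F V z.1 y).2) y = y.2 := by
    intro y hy
    rw [FiberBundle.extChartAt_target] at hy
    rw [writtenInExtChartAt, Function.comp_apply, Function.comp_apply, FiberBundle.extChartAt]
    exact congrArg Prod.snd ((trivializationAt F V z.proj).apply_symm_apply' (x := y.2) hy.1.2)
  refine (hasFDerivAt_snd (p := extChartAt (𝓘(ℝ, E).prod 𝓘(ℝ, F)) z z)).hasFDerivWithinAt
    |>.congr_of_eventuallyEq ?_ (key _ (mem_extChartAt_target z))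
  filter_upwards [extChartAt_target_mem_nhdsWithin (I := 𝓘(ℝ, E).prod 𝓘(ℝ, F)) z] with y hy
    using key y hy

lemma exists_frame (p : M) : ∃ S : F →ₗ[ℝ] Sec E F V,
    (∀ v, ∀ᶠ q in 𝓝 p, (S v).coord p q = v) ∧
    ∀ (L : LieAlgebroid E F V) (Y X : Sec E F V),
      L.bracket Y X p = L.bracket Y (S (X.coord p p)) p +
        (trivializationAt F V p).symmₗ ℝ p
          (mfderiv 𝓘(ℝ, E) 𝓘(ℝ, F) (X.coord p) p (L.anchor p (Y p))) := by
  set t := trivializationAt F V p with ht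
  have hp : p ∈ t.baseSet := mem_baseSet_trivializationAt F V p
  have hpn : t.baseSet ∈ 𝓝 p := t.open_baseSet.mem_nhds hp
  obtain ⟨b, hb1, hb⟩ := exists_bump (E := E) p t.baseSet hpn
  have hbp : b p = 1 := hb1.eq_of_nhds
  have hts : ∀ q ∈ t.baseSet, ∀ v, t ⟨q, t.symmₗ ℝ q v⟩ = (q, v) := fun q hq v => by
    rw [t.symmₗ_apply hq, t.mk_symm hq, t.apply_symm_apply' hq]
  have hst : ∀ q ∈ t.baseSet, ∀ v : V q, t.symmₗ ℝ q (t ⟨q, v⟩).2 = v := fun q hq v => by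
    have := t.symmₗ_linearMapAt (R := ℝ) hq v
    rwa [t.coe_linearMapAt_of_mem hq] at this
  have hsm : ∀ v : F, ContMDiffOn 𝓘(ℝ, E) (𝓘(ℝ, E).prod 𝓘(ℝ, F)) ∞
      (fun q => TotalSpace.mk' F q (t.symmₗ ℝ q v)) t.baseSet := by
    intro v
    rw [t.contMDiffOn_section_baseSet_iff]
    refine (contMDiffOn_const (c := v)).congr fun q hq => ?_
    rw [hts q hq]
  let S : F →ₗ[ℝ] Sec E F V :=
    { toFun := fun v => ⟨fun q => b q • t.symmₗ ℝ q v,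
        ContMDiffOn.smul_section_of_tsupport b.contMDiff.contMDiffOn t.open_baseSet hb (hsm v)⟩
      map_add' := fun v w => by
        ext q
        change b q • t.symmₗ ℝ q (v + w) = b q • t.symmₗ ℝ q v + b q • t.symmₗ ℝ q w
        rw [map_add, smul_add]
      map_smul' := fun r v => by
        ext q
        change b q • t.symmₗ ℝ q (r • v) = r • b q • t.symmₗ ℝ q v
        rw [map_smul, smul_comm] }
  have hS : ∀ v q, S v q = b q • t.symmₗ ℝ q v := fun v q => rfl
  refine ⟨S, fun v => ?_, fun L Y X => ?_⟩
  · filter_upwards [hb1, hpn] with q hq hqt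
    change (t ⟨q, b q • t.symmₗ ℝ q v⟩).2 = v
    rw [hq, Pi.one_apply, one_smul, hts q hqt]
  · let B := Module.finBasis ℝ F
    have hdX := X.mdifferentiableAt_coord p
    have hsf : ∀ i, ContMDiff 𝓘(ℝ, E) 𝓘(ℝ, ℝ) ∞ (fun q => b q * B.coord i (X.coord p q)) := by
      intro i
      refine contMDiff_of_tsupport fun q hq => ?_
      have hqt : t.baseSet ∈ 𝓝 q := t.open_baseSet.mem_nhds (hb (tsupport_mul_subset_left hq))
      have h1 : ContMDiff 𝓘(ℝ, F) 𝓘(ℝ, ℝ) ∞ (LinearMap.toContinuousLinearMap (B.coord i)) :=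
        ContinuousLinearMap.contMDiff _
      exact b.contMDiff.contMDiffAt.mul
        (h1.contMDiffAt.comp q ((X.contMDiffOn_coord p).contMDiffAt hqt))
    let f : Fin _ → C^∞⟮𝓘(ℝ, E), M; ℝ⟯ := fun i => ⟨_, hsf i⟩
    have hf : ∀ i q, f i q = b q * B.coord i (X.coord p q) := fun _ _ => rfl
    have hsum : ∀ (s : Finset (Fin (Module.finrank ℝ F))) (Z : Fin (Module.finrank ℝ F) → Sec E F V)
        (q : M), (∑ i ∈ s, Z i) q = ∑ i ∈ s, Z i q := fun s Z q => by
      have := congrFun (map_sum (ContMDiffSection.coeAddHom 𝓘(ℝ, E) F ∞ V) Z s) q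
      rw [Finset.sum_apply] at this
      exact this
    have key : X.fsmul (b * b) = ∑ i, (S (B i)).fsmul (f i) := by
      ext q
      rw [hsum]
      change (b q * b q) • X q = ∑ i, f i q • S (B i) q
      by_cases hq : q ∈ t.baseSet
      · have h1 : X q = ∑ i, B.coord i (X.coord p q) • t.symmₗ ℝ q (B i) := by
          rw [← hst q hq (X q)]
          simp_rw [← map_smul, ← map_sum]
          congr 1
          exact (B.sum_repr _).symm
        rw [h1, Finset.smul_sum]
        refine Finset.sum_congr rfl fun i _ => ?_
        rw [hf, hS, smul_smul, smul_smul]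
        congr 1
        ring
      · have : b q = 0 := image_eq_zero_of_notMem_tsupport fun h => hq (hb h)
        simp [hf, this]
    have h1 : L.bracket Y (X.fsmul (b * b)) p = L.bracket Y X p := by
      have hd : differential 𝓘(ℝ, E) (b * b : C^∞⟮𝓘(ℝ, E), M; ℝ⟯) p = 0 := by
        have : (⇑(b * b : C^∞⟮𝓘(ℝ, E), M; ℝ⟯)) =ᶠ[𝓝 p] fun _ => (1 : ℝ) := by
          filter_upwards [hb1] with q hq
          simp [hq]
        unfold differential
        rw [this.mfderiv_eq]
        exact mfderiv_const
      rw [L.leibniz, hd]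
      simp [hbp]
    have h2 : ∀ i, L.bracket Y ((S (B i)).fsmul (f i)) p =
        B.coord i (X.coord p p) • L.bracket Y (S (B i)) p + B.coord i
          (mfderiv 𝓘(ℝ, E) 𝓘(ℝ, F) (X.coord p) p (L.anchor p (Y p)) : F) • t.symmₗ ℝ p (B i) := by
      intro i
      have hd : differential 𝓘(ℝ, E) (f i) p (L.anchor p (Y p)) = B.coord i
          (mfderiv 𝓘(ℝ, E) 𝓘(ℝ, F) (X.coord p) p (L.anchor p (Y p)) : F) := by
        have : (f i) =ᶠ[𝓝 p] (LinearMap.toContinuousLinearMap (B.coord i)) ∘ (X.coord p) := by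
          filter_upwards [hb1] with q hq
          simp [hf, hq]
        unfold differential
        rw [this.mfderiv_eq]
        have h3 := (LinearMap.toContinuousLinearMap (B.coord i)).hasMFDerivAt
          (x := X.coord p p)
        rw [(h3.comp p hdX.hasMFDerivAt).mfderiv]
        rfl
      rw [L.leibniz, hd, hf, hS, hbp]
      simp
    rw [← h1, key, map_sum, hsum]
    simp_rw [h2]
    rw [Finset.sum_add_distrib]
    congr 1
    · have h3 : S (X.coord p p) = ∑ i, B.coord i (X.coord p p) • S (B i) := by
        simp_rw [← map_smul, ← map_sum]
        congr 1
        exact (B.sum_repr _).symm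
      rw [h3, map_sum, hsum]
      refine Finset.sum_congr rfl fun i _ => ?_
      rw [map_smul]
      rfl
    · simp_rw [← map_smul, ← map_sum]
      congr 1
      exact B.sum_repr _

end LocalFrames

section PoissonAndCompleteLift

variable {E : Type*} [NormedAddCommGroup E] [NormedSpace ℝ E] [FiniteDimensional ℝ E]
  {M : Type*} [TopologicalSpace M] [ChartedSpace E M] [IsManifold 𝓘(ℝ, E) ∞ M] [T2Space M]
  {F : Type*} [NormedAddCommGroup F] [NormedSpace ℝ F] [FiniteDimensional ℝ F]
  {W : M → Type*} [∀ p, AddCommGroup (W p)] [∀ p, Module ℝ (W p)]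
  [∀ p, TopologicalSpace (W p)] [TopologicalSpace (TotalSpace F W)]
  [FiberBundle F W] [VectorBundle ℝ F W] [ContMDiffVectorBundle ∞ F W 𝓘(ℝ, E)]

lemma exists_differential_eq (p : M) (h : E →L[ℝ] ℝ) :
    ∃ f : C^∞⟮𝓘(ℝ, E), M; ℝ⟯, differential 𝓘(ℝ, E) f p = h := by
  obtain ⟨b, hb1, hb⟩ := exists_bump (E := E) p (chartAt E p).source (chart_source_mem_nhds E p)
  have hs : ContMDiff 𝓘(ℝ, E) 𝓘(ℝ, ℝ) ∞ (fun q => b q * h (extChartAt 𝓘(ℝ, E) p q)) := by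
    refine contMDiff_of_tsupport fun q hq => ?_
    have hq' := hb (tsupport_mul_subset_left hq)
    exact b.contMDiff.contMDiffAt.mul (h.contMDiff.contMDiffAt.comp q (contMDiffAt_extChartAt' hq'))
  refine ⟨⟨_, hs⟩, ?_⟩
  have h1 : (fun q => b q * h (extChartAt 𝓘(ℝ, E) p q)) =ᶠ[𝓝 p] h ∘ extChartAt 𝓘(ℝ, E) p := by
    filter_upwards [hb1] with q hq
    simp [hq]
  have h2 : HasMFDerivAt 𝓘(ℝ, E) 𝓘(ℝ, E) (extChartAt 𝓘(ℝ, E) p) p (ContinuousLinearMap.id ℝ E) := by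
    refine ⟨continuousAt_extChartAt p, ?_⟩
    have key : ∀ y ∈ (extChartAt 𝓘(ℝ, E) p).target,
        writtenInExtChartAt 𝓘(ℝ, E) 𝓘(ℝ, E) p (extChartAt 𝓘(ℝ, E) p) y = y := fun y hy =>
      (extChartAt 𝓘(ℝ, E) p).right_inv hy
    refine (hasFDerivAt_id _).hasFDerivWithinAt.congr_of_eventuallyEq ?_
      (key _ (mem_extChartAt_target p))
    filter_upwards [extChartAt_target_mem_nhdsWithin (I := 𝓘(ℝ, E)) p] with y hy using key y hy
  change mfderiv 𝓘(ℝ, E) 𝓘(ℝ, ℝ) (fun q => b q * h (extChartAt 𝓘(ℝ, E) p q)) p = h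
  rw [h1.mfderiv_eq]
  exact ((h.hasMFDerivAt).comp p h2).mfderiv

lemma hasMFDerivAt_clm_apply {B H N : Type*} [NormedAddCommGroup B] [NormedSpace ℝ B]
    [TopologicalSpace H] {I : ModelWithCorners ℝ B H} [TopologicalSpace N] [ChartedSpace H N]
    {c : N → F →L[ℝ] ℝ} {τ : N → F} {x : N} {c' : TangentSpace I x →L[ℝ] (F →L[ℝ] ℝ)}
    {τ' : TangentSpace I x →L[ℝ] F} (hc : HasMFDerivAt I 𝓘(ℝ, F →L[ℝ] ℝ) c x c')
    (hτ : HasMFDerivAt I 𝓘(ℝ, F) τ x τ') (v : TangentSpace I x) :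
    differential I (fun y => c y (τ y)) x v = c' v (τ x) + c x (τ' v) := by
  have hc2 : HasFDerivWithinAt (c ∘ (extChartAt I x).symm) (c' : B →L[ℝ] (F →L[ℝ] ℝ))
    (range I) (extChartAt I x x) := hc.2
  have hτ2 : HasFDerivWithinAt (τ ∘ (extChartAt I x).symm) (τ' : B →L[ℝ] F)
    (range I) (extChartAt I x x) := hτ.2
  have h3 := hc2.clm_apply hτ2
  have h4 : HasMFDerivAt I 𝓘(ℝ, ℝ) (fun y => c y (τ y)) x _ := ⟨hc.1.clm_apply hτ.1, h3⟩
  unfold differential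
  rw [h4.mfderiv, add_comm (c' v (τ x))]
  have h5 : (extChartAt I x).symm (extChartAt I x x) = x := extChartAt_to_inv x
  simp only [Function.comp_apply, h5]
  rfl

/-- The differential at `p` of the local representative of a section near `p`. -/
def Sec.dcoord (X : Sec E F W) (p : M) : E →L[ℝ] F := mfderiv 𝓘(ℝ, E) 𝓘(ℝ, F) (X.coord p) p

lemma dual_apply_eq {p q : M} (hq : q ∈ (trivializationAt F W p).baseSet) (φ : DualBundle W q)
    (v : W q) : (φ v : ℝ) =
      (trivializationAt (F →L[ℝ] ℝ) (DualBundle W) p ⟨q, φ⟩).2 (trivializationAt F W p ⟨q, v⟩).2 := by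
  rw [hom_trivializationAt_apply]
  simp only [ContinuousLinearMap.inCoordinates]
  change _ = (trivializationAt ℝ (Bundle.Trivial M ℝ) p).linearMapAt ℝ q
    (φ ((trivializationAt F W p).symmL ℝ q (trivializationAt F W p ⟨q, v⟩).2))
  rw [Trivialization.coe_linearMapAt_of_mem _ (mem_univ q)]
  have := (trivializationAt F W p).symmₗ_linearMapAt (R := ℝ) hq v
  rw [Trivialization.coe_linearMapAt_of_mem _ hq] at this
  change _ = φ ((trivializationAt F W p).symmₗ ℝ q (trivializationAt F W p ⟨q, v⟩).2)
  rw [this]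

lemma differential_comp_proj (f : C^∞⟮𝓘(ℝ, E), M; ℝ⟯) (w : TotalSpace F W) (v : E × F) :
    differential (𝓘(ℝ, E).prod 𝓘(ℝ, F)) (f ∘ π F W) w v = differential 𝓘(ℝ, E) f w.1 v.1 := by
  have hf : MDifferentiableAt 𝓘(ℝ, E) 𝓘(ℝ, ℝ) f w.1 := f.contMDiff.mdifferentiable (by simp) _
  unfold differential
  rw [(hf.hasMFDerivAt.comp w (hasMFDerivAt_bundle_proj w)).mfderiv]
  rfl

lemma differential_linearFun (X : Sec E (F →L[ℝ] ℝ) (DualBundle W)) (w : TotalSpace F W)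
    (v : E × F) : differential (𝓘(ℝ, E).prod 𝓘(ℝ, F)) (linearFun X) w v =
      X.dcoord w.1 v.1 (trivializationAt F W w.1 w).2 + X.coord w.1 w.1 v.2 := by
  have h1 : linearFun X =ᶠ[𝓝 w]
      fun z => (X.coord w.1 ∘ π F W) z (trivializationAt F W w.1 z).2 := by
    have : π F W ⁻¹' (trivializationAt F W w.1).baseSet ∈ 𝓝 w :=
      (FiberBundle.continuous_proj F W).continuousAt.preimage_mem_nhds
        ((trivializationAt F W w.1).open_baseSet.mem_nhds (mem_baseSet_trivializationAt F W w.1))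
    filter_upwards [this] with z hz using dual_apply_eq hz _ _
  have h2 := hasMFDerivAt_clm_apply
    ((X.mdifferentiableAt_coord w.1).hasMFDerivAt.comp w (hasMFDerivAt_bundle_proj w))
    (hasMFDerivAt_bundle_snd w) v
  unfold differential at h2 ⊢
  rw [h1.mfderiv_eq]
  exact h2

lemma differential_linearFunDual (μ : Sec E F W) (e : TotalSpace (F →L[ℝ] ℝ) (DualBundle W))
    (v : E × (F →L[ℝ] ℝ)) :
    differential (𝓘(ℝ, E).prod 𝓘(ℝ, F →L[ℝ] ℝ)) (linearFunDual μ) e v =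
      v.2 (μ.coord e.1 e.1) + (trivializationAt (F →L[ℝ] ℝ) (DualBundle W) e.1 e).2
        (μ.dcoord e.1 v.1) := by
  have h1 : linearFunDual μ =ᶠ[𝓝 e] fun z =>
      (trivializationAt (F →L[ℝ] ℝ) (DualBundle W) e.1 z).2 ((μ.coord e.1 ∘ π _ _) z) := by
    have : π _ _ ⁻¹' (trivializationAt F W e.1).baseSet ∈ 𝓝 e :=
      (FiberBundle.continuous_proj (F →L[ℝ] ℝ) (DualBundle W)).continuousAt.preimage_mem_nhds
        ((trivializationAt F W e.1).open_baseSet.mem_nhds (mem_baseSet_trivializationAt F W e.1))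
    filter_upwards [this] with z hz using dual_apply_eq hz _ _
  have h2 := hasMFDerivAt_clm_apply (hasMFDerivAt_bundle_snd e)
    ((μ.mdifferentiableAt_coord e.1).hasMFDerivAt.comp e (hasMFDerivAt_bundle_proj e)) v
  unfold differential at h2 ⊢
  rw [h1.mfderiv_eq]
  exact h2

lemma differential_pairing (μ : Sec E F W) (X : Sec E (F →L[ℝ] ℝ) (DualBundle W)) (p : M) (v : E) :
    differential 𝓘(ℝ, E) (pairing μ X) p v =
      X.dcoord p v (μ.coord p p) +
        X.coord p p (μ.dcoord p v) := by
  have h1 : pairing μ X =ᶠ[𝓝 p] fun q => X.coord p q (μ.coord p q) := by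
    filter_upwards [(trivializationAt F W p).open_baseSet.mem_nhds
      (mem_baseSet_trivializationAt F W p)] with q hq using dual_apply_eq hq _ _
  have h2 := hasMFDerivAt_clm_apply (X.mdifferentiableAt_coord p).hasMFDerivAt
    (μ.mdifferentiableAt_coord p).hasMFDerivAt v
  unfold differential at h2 ⊢
  rw [h1.mfderiv_eq]
  exact h2

end PoissonAndCompleteLift

section PoissonAndCompleteLift

variable {E : Type*} [NormedAddCommGroup E] [NormedSpace ℝ E] [FiniteDimensional ℝ E]
  {M : Type*} [TopologicalSpace M] [ChartedSpace E M] [IsManifold 𝓘(ℝ, E) ∞ M] [T2Space M]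
  {F : Type*} [NormedAddCommGroup F] [NormedSpace ℝ F] [FiniteDimensional ℝ F]
  {W : M → Type*} [∀ p, AddCommGroup (W p)] [∀ p, Module ℝ (W p)]
  [∀ p, TopologicalSpace (W p)] [TopologicalSpace (TotalSpace F W)]
  [FiberBundle F W] [VectorBundle ℝ F W] [ContMDiffVectorBundle ∞ F W 𝓘(ℝ, E)]

/-- The cotangent space at a point of a manifold. -/
abbrev Cotangent {B H N : Type*} [NormedAddCommGroup B] [NormedSpace ℝ B] [TopologicalSpace H]
    (I : ModelWithCorners ℝ B H) [TopologicalSpace N] [ChartedSpace H N] (x : N) : Type _ :=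
  TangentSpace I x →L[ℝ] ℝ

variable (L : LieAlgebroid E (F →L[ℝ] ℝ) (DualBundle W))

/-- The values at the point `w ∈ W` of the linear Poisson tensor of a Lie algebroid `W*`:
`{ι_X, ι_Y} = ι_[X,Y]`, `{ι_X, f ∘ π} = ρ(X)(f) ∘ π` and `{f ∘ π, g ∘ π} = 0`. -/
structure IsLinearPoissonAt (w : TotalSpace F W)
    (Λ : Cotangent (𝓘(ℝ, E).prod 𝓘(ℝ, F)) w →ₗ[ℝ]
      Cotangent (𝓘(ℝ, E).prod 𝓘(ℝ, F)) w →ₗ[ℝ] ℝ) : Prop where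
  alternating : ∀ ξ, Λ ξ ξ = 0
  linear_linear : ∀ X Y : Sec E (F →L[ℝ] ℝ) (DualBundle W),
    Λ (differential (𝓘(ℝ, E).prod 𝓘(ℝ, F)) (linearFun X) w)
    (differential (𝓘(ℝ, E).prod 𝓘(ℝ, F)) (linearFun Y) w) = linearFun (L.bracket X Y) w
  linear_basic : ∀ (X : Sec E (F →L[ℝ] ℝ) (DualBundle W)) (f : C^∞⟮𝓘(ℝ, E), M; ℝ⟯),
    Λ (differential (𝓘(ℝ, E).prod 𝓘(ℝ, F)) (linearFun X) w)
      (differential (𝓘(ℝ, E).prod 𝓘(ℝ, F)) (f ∘ π F W) w) =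
        differential 𝓘(ℝ, E) f w.1 (L.anchor w.1 (X w.1))
  basic_basic : ∀ f g : C^∞⟮𝓘(ℝ, E), M; ℝ⟯,
    Λ (differential (𝓘(ℝ, E).prod 𝓘(ℝ, F)) (f ∘ π F W) w)
      (differential (𝓘(ℝ, E).prod 𝓘(ℝ, F)) (g ∘ π F W) w) = 0

/-- The Lie derivative of the 1-form `μ` along `X`, evaluated on `Y`. -/
def lieDeriv₁ (X : Sec E (F →L[ℝ] ℝ) (DualBundle W)) (μ : Sec E F W)
    (Y : Sec E (F →L[ℝ] ℝ) (DualBundle W)) (p : M) : ℝ :=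
  differential 𝓘(ℝ, E) (pairing μ Y) p (L.anchor p (X p)) - pairing μ (L.bracket X Y) p

/-- The value `v` at the point `e ∈ W*` of the complete lift `X^c` of a section `X` of the Lie
algebroid `W*`: `X^c(f ∘ π) = ρ(X)(f) ∘ π` and `X^c(ι_μ) = ι_(L_X μ)`. -/
structure IsCompleteLiftAt (X : Sec E (F →L[ℝ] ℝ) (DualBundle W))
    (e : TotalSpace (F →L[ℝ] ℝ) (DualBundle W))
    (v : TangentSpace (𝓘(ℝ, E).prod 𝓘(ℝ, F →L[ℝ] ℝ)) e) : Prop where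
  basic : ∀ f : C^∞⟮𝓘(ℝ, E), M; ℝ⟯,
    differential (𝓘(ℝ, E).prod 𝓘(ℝ, F →L[ℝ] ℝ)) (f ∘ π (F →L[ℝ] ℝ) (DualBundle W)) e v =
      differential 𝓘(ℝ, E) f e.1 (L.anchor e.1 (X e.1))
  linear : ∀ (μ : Sec E F W) (Y : Sec E (F →L[ℝ] ℝ) (DualBundle W)), Y e.1 = e.2 →
    differential (𝓘(ℝ, E).prod 𝓘(ℝ, F →L[ℝ] ℝ)) (linearFunDual μ) e v = lieDeriv₁ L X μ Y e.1

lemma coord_injective {F : Type*} [NormedAddCommGroup F] [NormedSpace ℝ F] {V : M → Type*}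
    [∀ p, AddCommGroup (V p)] [∀ p, Module ℝ (V p)]
    [∀ p, TopologicalSpace (V p)] [TopologicalSpace (TotalSpace F V)]
    [FiberBundle F V] [VectorBundle ℝ F V] {p : M} {v w : V p}
    (h : (trivializationAt F V p ⟨p, v⟩).2 = (trivializationAt F V p ⟨p, w⟩).2) : v = w :=
  (fiberEquiv (trivializationAt F V p) p (mem_baseSet_trivializationAt F V p)).injective h

lemma dual_symm_apply {p : M} (γ : F →L[ℝ] ℝ) (v : W p) :
    ((trivializationAt (F →L[ℝ] ℝ) (DualBundle W) p).symmₗ ℝ p γ v : ℝ) =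
      γ (trivializationAt F W p ⟨p, v⟩).2 := by
  have hp := mem_baseSet_trivializationAt (F →L[ℝ] ℝ) (DualBundle W) p
  rw [dual_apply_eq (mem_baseSet_trivializationAt F W p), Trivialization.symmₗ_apply _ hp,
    Trivialization.mk_symm _ hp, Trivialization.apply_symm_apply' _ hp]

set_option maxHeartbeats 1000000 in
theorem existsUnique_isLinearPoissonAt (w : TotalSpace F W) : ∃! Λ, IsLinearPoissonAt L w Λ := by
  obtain ⟨p, w₀⟩ := w
  obtain ⟨S, hS, hB⟩ := exists_frame (E := E) (F := F →L[ℝ] ℝ) (V := DualBundle W) p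
  have hSp : ∀ γ, (S γ).coord p p = γ := fun γ => (hS γ).self_of_nhds
  have hSd : ∀ γ, (S γ).dcoord p = 0 := fun γ => by
    have : (S γ).coord p =ᶠ[𝓝 p] fun _ => γ := hS γ
    unfold Sec.dcoord
    rw [this.mfderiv_eq]
    exact mfderiv_const
  have hSX : ∀ X : Sec E (F →L[ℝ] ℝ) (DualBundle W), S (X.coord p p) p = X p := fun X =>
    coord_injective (hSp _)
  set g₀ := (trivializationAt F W p ⟨p, w₀⟩).2 with hg₀
  have hB1 : ∀ Y X, L.bracket Y X p w₀ =
      L.bracket Y (S (X.coord p p)) p w₀ + X.dcoord p (L.anchor p (Y p)) g₀ := fun Y X => by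
    refine (congrArg (fun φ : DualBundle W p => (φ w₀ : ℝ)) (hB L Y X)).trans ?_
    exact congrArg _ (dual_symm_apply (X.dcoord p (L.anchor p (Y p))) w₀)
  have hsk : ∀ X Y, L.bracket X Y p w₀ = -(L.bracket Y X p w₀) := fun X Y => by
    rw [L.bracket_skew X Y]
    rfl
  have hB2 : ∀ X Y, L.bracket X Y p w₀ =
      L.bracket (S (X.coord p p)) (S (Y.coord p p)) p w₀ + Y.dcoord p (L.anchor p (X p)) g₀ -
        X.dcoord p (L.anchor p (Y p)) g₀ := fun X Y => by
    rw [hB1 X Y, hsk X, hB1 (S _) X, hsk (S (X.coord p p)), hSX]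
    ring
  let vert : (E × F →L[ℝ] ℝ) →ₗ[ℝ] (F →L[ℝ] ℝ) :=
    { toFun := fun ξ => ξ ∘L ContinuousLinearMap.inr ℝ E F
      map_add' := fun _ _ => rfl
      map_smul' := fun _ _ => rfl }
  let hor : (E × F →L[ℝ] ℝ) →ₗ[ℝ] (E →L[ℝ] ℝ) :=
    { toFun := fun ξ => ξ ∘L ContinuousLinearMap.inl ℝ E F
      map_add' := fun _ _ => rfl
      map_smul' := fun _ _ => rfl }
  let ρ : (F →L[ℝ] ℝ) → E := fun γ => L.anchor p (S γ p)
  have hρa : ∀ γ δ, ρ (γ + δ) = ρ γ + ρ δ := fun γ δ => by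
    change L.anchor p (S (γ + δ) p) = _
    rw [map_add]
    exact map_add (L.anchor p) _ _
  have hρs : ∀ (r : ℝ) γ, ρ (r • γ) = r • ρ γ := fun r γ => by
    change L.anchor p (S (r • γ) p) = _
    rw [map_smul]
    exact map_smul (L.anchor p) _ _
  let Λ : (E × F →L[ℝ] ℝ) →ₗ[ℝ] (E × F →L[ℝ] ℝ) →ₗ[ℝ] ℝ := LinearMap.mk₂ ℝ
    (fun ξ η => (L.bracket (S (vert ξ)) (S (vert η)) p w₀ : ℝ) + hor η (ρ (vert ξ)) -
      hor ξ (ρ (vert η)))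
    (fun ξ ξ' η => by
      simp only [map_add, hρa, LinearMap.add_apply, ContMDiffSection.coe_add, Pi.add_apply,
        _root_.add_apply]
      ring)
    (fun r ξ η => by
      simp only [map_smul, hρs, LinearMap.smul_apply, ContMDiffSection.coe_smul, Pi.smul_apply,
        _root_.smul_apply, smul_eq_mul]
      ring)
    (fun ξ η η' => by
      simp only [map_add, hρa, ContMDiffSection.coe_add, Pi.add_apply,
        _root_.add_apply]
      ring)
    (fun r ξ η => by
      simp only [map_smul, hρs, ContMDiffSection.coe_smul, Pi.smul_apply,
        _root_.smul_apply, smul_eq_mul]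
      ring)
  have hΛ : ∀ ξ η, Λ ξ η = (L.bracket (S (vert ξ)) (S (vert η)) p w₀ : ℝ) + hor η (ρ (vert ξ)) -
      hor ξ (ρ (vert η)) := fun _ _ => rfl
  have hvX : ∀ X : Sec E (F →L[ℝ] ℝ) (DualBundle W),
      vert (differential (𝓘(ℝ, E).prod 𝓘(ℝ, F)) (linearFun X) (⟨p, w₀⟩ : TotalSpace F W)) =
        X.coord p p := fun X => by
    ext g
    refine (differential_linearFun X (⟨p, w₀⟩ : TotalSpace F W) (0, g)).trans ?_
    simp
  have hhX : ∀ (X : Sec E (F →L[ℝ] ℝ) (DualBundle W)) (u : E),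
      hor (differential (𝓘(ℝ, E).prod 𝓘(ℝ, F)) (linearFun X) (⟨p, w₀⟩ : TotalSpace F W)) u =
        X.dcoord p u g₀ := fun X u => by
    refine (differential_linearFun X (⟨p, w₀⟩ : TotalSpace F W) (u, 0)).trans ?_
    simp [hg₀]
  have hvf : ∀ f : C^∞⟮𝓘(ℝ, E), M; ℝ⟯,
      vert (differential (𝓘(ℝ, E).prod 𝓘(ℝ, F)) (f ∘ π F W) (⟨p, w₀⟩ : TotalSpace F W)) = 0 :=
    fun f => by
      ext g
      refine (differential_comp_proj f (⟨p, w₀⟩ : TotalSpace F W) (0, g)).trans ?_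
      exact map_zero (differential 𝓘(ℝ, E) f p)
  have hhf : ∀ (f : C^∞⟮𝓘(ℝ, E), M; ℝ⟯) (u : E),
      hor (differential (𝓘(ℝ, E).prod 𝓘(ℝ, F)) (f ∘ π F W) (⟨p, w₀⟩ : TotalSpace F W)) u =
        differential 𝓘(ℝ, E) f p u :=
    fun f u => differential_comp_proj f (⟨p, w₀⟩ : TotalSpace F W) (u, 0)
  have hρX : ∀ X : Sec E (F →L[ℝ] ℝ) (DualBundle W), ρ (X.coord p p) = L.anchor p (X p) :=
    fun X => congrArg (L.anchor p) (hSX X)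
  have hρ0 : ρ 0 = 0 := by
    have := hρs 0 0
    simpa using this
  have hrep : ∀ ξ : E × F →L[ℝ] ℝ, ∃ (X : Sec E (F →L[ℝ] ℝ) (DualBundle W))
      (f : C^∞⟮𝓘(ℝ, E), M; ℝ⟯), ξ =
        differential (𝓘(ℝ, E).prod 𝓘(ℝ, F)) (linearFun X) (⟨p, w₀⟩ : TotalSpace F W) +
        differential (𝓘(ℝ, E).prod 𝓘(ℝ, F)) (f ∘ π F W) (⟨p, w₀⟩ : TotalSpace F W) := fun ξ => by
    obtain ⟨f, hf⟩ := exists_differential_eq (E := E) p (hor ξ)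
    refine ⟨S (vert ξ), f, ?_⟩
    refine ContinuousLinearMap.ext fun v => ?_
    change ξ v = differential (𝓘(ℝ, E).prod 𝓘(ℝ, F)) (linearFun _) (⟨p, w₀⟩ : TotalSpace F W) v +
      differential (𝓘(ℝ, E).prod 𝓘(ℝ, F)) (f ∘ π F W) (⟨p, w₀⟩ : TotalSpace F W) v
    rw [differential_linearFun, differential_comp_proj]
    simp only [hSd, hSp, hf]
    change ξ v = 0 + ξ (0, v.2) + ξ (v.1, 0)
    rw [zero_add, ← map_add]
    simp
  have hex : IsLinearPoissonAt L (⟨p, w₀⟩ : TotalSpace F W) Λ := by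
    refine ⟨fun ξ => ?_, fun X Y => ?_, fun X f => ?_, fun f g => ?_⟩
    · have := hsk (S (vert ξ)) (S (vert ξ))
      refine (hΛ ξ ξ).trans ?_
      have h0 : (L.bracket (S (vert ξ)) (S (vert ξ)) p w₀ : ℝ) = 0 := by linarith
      rw [h0]
      exact (add_sub_assoc _ _ _).trans (by rw [zero_add]; exact sub_self _)
    · refine (hΛ _ _).trans ?_
      rw [hvX, hvX, hhX, hhX, hρX, hρX]
      exact (hB2 X Y).symm
    · refine (hΛ _ _).trans ?_
      rw [hvX, hvf, hhX, hhf, hρX, hρ0]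
      simp
    · refine (hΛ _ _).trans ?_
      rw [hvf, hvf, hhf, hhf, hρ0]
      have h0 : ∀ h : C^∞⟮𝓘(ℝ, E), M; ℝ⟯, differential 𝓘(ℝ, E) h p (0 : E) = 0 := fun h =>
        map_zero (differential 𝓘(ℝ, E) h p)
      rw [h0, h0]
      simp
  refine ⟨Λ, hex, fun Λ' h' => ?_⟩
  have hneg : ∀ Λ₁ : (E × F →L[ℝ] ℝ) →ₗ[ℝ] (E × F →L[ℝ] ℝ) →ₗ[ℝ] ℝ, (∀ ξ, Λ₁ ξ ξ = 0) →
      ∀ ξ η, Λ₁ ξ η = -Λ₁ η ξ := fun Λ₁ h ξ η => by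
    have h1 := h (ξ + η)
    simp only [map_add, LinearMap.add_apply, h, zero_add, add_zero] at h1
    linarith
  refine LinearMap.ext fun ξ => LinearMap.ext fun η => ?_
  obtain ⟨X, f, rfl⟩ := hrep ξ
  obtain ⟨Y, g, rfl⟩ := hrep η
  have hsum : ∀ (Λ₁ : (E × F →L[ℝ] ℝ) →ₗ[ℝ] (E × F →L[ℝ] ℝ) →ₗ[ℝ] ℝ)
      (_ : IsLinearPoissonAt L (⟨p, w₀⟩ : TotalSpace F W) Λ₁),
      Λ₁ (differential (𝓘(ℝ, E).prod 𝓘(ℝ, F)) (linearFun X) (⟨p, w₀⟩ : TotalSpace F W) +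
          differential (𝓘(ℝ, E).prod 𝓘(ℝ, F)) (f ∘ π F W) (⟨p, w₀⟩ : TotalSpace F W))
        (differential (𝓘(ℝ, E).prod 𝓘(ℝ, F)) (linearFun Y) (⟨p, w₀⟩ : TotalSpace F W) +
          differential (𝓘(ℝ, E).prod 𝓘(ℝ, F)) (g ∘ π F W) (⟨p, w₀⟩ : TotalSpace F W)) =
      linearFun (L.bracket X Y) (⟨p, w₀⟩ : TotalSpace F W) +
        differential 𝓘(ℝ, E) g p (L.anchor p (X p)) -
        differential 𝓘(ℝ, E) f p (L.anchor p (Y p)) := fun Λ₁ h => by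
    have hbil : ∀ a b c d : E × F →L[ℝ] ℝ,
        Λ₁ (a + b) (c + d) = Λ₁ a c + Λ₁ a d - Λ₁ c b + Λ₁ b d := fun a b c d => by
      rw [hneg Λ₁ h.alternating c b]
      simp only [map_add, LinearMap.add_apply]
      ring
    refine (hbil _ _ _ _).trans ?_
    refine (congrArg₂ (· + ·) (congrArg₂ (· - ·) (congrArg₂ (· + ·) (h.linear_linear X Y)
      (h.linear_basic X g)) (h.linear_basic Y f)) (h.basic_basic f g)).trans ?_
    exact add_zero _
  exact (hsum Λ' h').trans (hsum Λ hex).symm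

theorem existsUnique_isCompleteLiftAt (X : Sec E (F →L[ℝ] ℝ) (DualBundle W))
    (e : TotalSpace (F →L[ℝ] ℝ) (DualBundle W)) : ∃! v, IsCompleteLiftAt L X e v := by
  obtain ⟨p, e₀⟩ := e
  obtain ⟨S, hS, hB⟩ := exists_frame (E := E) (F := F →L[ℝ] ℝ) (V := DualBundle W) p
  obtain ⟨T, hT, -⟩ := exists_frame (E := E) (F := F) (V := W) p
  have hTp : ∀ g, (T g).coord p p = g := fun g => (hT g).self_of_nhds
  set γ₀ := (trivializationAt (F →L[ℝ] ℝ) (DualBundle W) p ⟨p, e₀⟩).2 with hγ₀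
  have hS₀ : S γ₀ p = e₀ := coord_injective ((hS γ₀).self_of_nhds)
  let u : E := L.anchor p (X p)
  let γ : F →L[ℝ] ℝ := -(L.bracket X (S γ₀)).coord p p
  have key : ∀ (μ : Sec E F W) (Y : Sec E (F →L[ℝ] ℝ) (DualBundle W)), Y p = e₀ →
      lieDeriv₁ L X μ Y p = γ (μ.coord p p) + γ₀ (μ.dcoord p u) := by
    intro μ Y hY
    have h1 : Y.coord p p = γ₀ := by rw [Sec.coord, hY]
    have h2 : pairing μ (L.bracket X Y) p =
        (L.bracket X (S γ₀)).coord p p (μ.coord p p) + Y.dcoord p u (μ.coord p p) := by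
      refine (congrArg (fun φ : DualBundle W p => (φ (μ p) : ℝ)) (hB L X Y)).trans ?_
      rw [h1]
      exact congrArg₂ (· + ·) (dual_apply_eq (mem_baseSet_trivializationAt F W p) _ _)
        (dual_symm_apply (Y.dcoord p u) (μ p))
    refine (congrArg₂ (· - ·) (differential_pairing μ Y p u) h2).trans ?_
    rw [h1]
    change _ = -((L.bracket X (S γ₀)).coord p p (μ.coord p p)) + _
    ring
  refine ⟨((u, γ) : E × (F →L[ℝ] ℝ)), ⟨fun f => ?_, fun μ Y hY => ?_⟩, fun v hv => ?_⟩
  · exact differential_comp_proj f (⟨p, e₀⟩ : TotalSpace (F →L[ℝ] ℝ) (DualBundle W)) (u, γ)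
  · rw [key μ Y hY]
    exact differential_linearFunDual μ (⟨p, e₀⟩ : TotalSpace (F →L[ℝ] ℝ) (DualBundle W)) (u, γ)
  · have hv1 : (v : E × (F →L[ℝ] ℝ)).1 = u := by
      refine (SeparatingDual.eq_iff_forall_dual_eq (R := ℝ)).2 fun h => ?_
      obtain ⟨f, hf⟩ := exists_differential_eq (E := E) p h
      have h1 := (differential_comp_proj f (⟨p, e₀⟩ : TotalSpace (F →L[ℝ] ℝ) (DualBundle W))
        v).symm.trans (hv.basic f)
      change differential 𝓘(ℝ, E) f p _ = differential 𝓘(ℝ, E) f p _ at h1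
      rw [hf] at h1
      exact h1
    have hv2 : (v : E × (F →L[ℝ] ℝ)).2 = γ := by
      ext g
      have h1 := (differential_linearFunDual (T g) (⟨p, e₀⟩ : TotalSpace (F →L[ℝ] ℝ)
        (DualBundle W)) v).symm.trans ((hv.linear (T g) (S γ₀) hS₀).trans (key _ _ hS₀))
      rw [hv1] at h1
      simp only [hTp] at h1
      exact add_right_cancel h1
    exact Prod.ext hv1 hv2

/-- The linear Poisson tensor on `W` of a Lie algebroid `W*`. -/
def linearPoissonTensor (w : TotalSpace F W) : Cotangent (𝓘(ℝ, E).prod 𝓘(ℝ, F)) w →ₗ[ℝ]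
    Cotangent (𝓘(ℝ, E).prod 𝓘(ℝ, F)) w →ₗ[ℝ] ℝ :=
  (existsUnique_isLinearPoissonAt L w).choose

/-- The complete lift of a section of a Lie algebroid `W*`, a vector field on `W*`. -/
def completeLift (X : Sec E (F →L[ℝ] ℝ) (DualBundle W))
    (e : TotalSpace (F →L[ℝ] ℝ) (DualBundle W)) :
    TangentSpace (𝓘(ℝ, E).prod 𝓘(ℝ, F →L[ℝ] ℝ)) e :=
  (existsUnique_isCompleteLiftAt L X e).choose

/-- The Lie derivative of a bivector field `Λ` along a vector field `ζ`, evaluated on the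
differentials of two functions:
`(L_ζ Λ)(df, dg) = ζ(Λ(df, dg)) - Λ(d(ζ f), dg) - Λ(df, d(ζ g))`. -/
def lieDerivBivector {B H N : Type*} [NormedAddCommGroup B] [NormedSpace ℝ B] [TopologicalSpace H]
    (I : ModelWithCorners ℝ B H) [TopologicalSpace N] [ChartedSpace H N]
    (ζ : ∀ x : N, TangentSpace I x) (Λ : ∀ x : N, Cotangent I x →ₗ[ℝ] Cotangent I x →ₗ[ℝ] ℝ)
    (f g : N → ℝ) (x : N) : ℝ :=
  differential I (fun y => Λ y (differential I f y) (differential I g y)) x (ζ x) -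
    Λ x (differential I (fun y => differential I f y (ζ y)) x) (differential I g x) -
    Λ x (differential I f x) (differential I (fun y => differential I g y (ζ y)) x)

end PoissonAndCompleteLift

end

/-! Write φ for `oneSection`. Each of the five conditions turns out to say that ⟨φ, [X, Y]⟩ = 0 for
all sections X, Y of A. For such sections ⟨φ, X⟩ and ⟨φ, Y⟩ are the constant 1, so the derivative
terms of dφ(X, Y) vanish and dφ(X, Y) = -⟨φ, [X, Y]⟩ (`extDeriv₁_oneSection_hullSection`).

(2) ⇔ (3). A section of Â lies in V(A) exactly when φ annihilates it (`exists_hullVector_eq`,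
`hullVector_apply_one`). The form dφ is skew and C^∞-bilinear, and once a section α of A is fixed,
every section X of Â is (⟨φ, X⟩ - 1) α + β with β a section of A
(`exists_eq_fsmul_hullSection_add`). Hence dφ = 0 can be tested on sections of A. That α exists is a
partition of unity argument (`exists_pairing_oneSection_eq_one`).

(1) ⇔ (2). Only the construction of a Lie affgebroid needs an argument: V(A) → Â is injective on
fibres, so every axiom can be checked in Â, where it follows from the Lie algebroid axioms
(`inducedLieAffgebroid`).

(5) ⇔ (3). Along A the tangent space of A is the kernel of dι_φ (`mem_range_mfderiv_hullMap_iff`).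
The value of X^c(ι_φ) = ι_{L_X φ} at a point Y(p) of A is -⟨φ, [X, Y]⟩(p), and each point of A lies
on a section (`exists_affine_section_through`).

(4) ⇔ (3). On linear functions, L_{V(φ)} Λ is -dφ (`lieDerivBivector_verticalLift_linearFun`), which
gives (3) from (4). For the converse arbitrary smooth functions must be handled. Near a point of A†
the chart coordinates are sums of linear and basic functions (`exists_affineFun_eventuallyEq`). In
them V(φ) has constant components, because φ has constant local coordinates, and the derivatives of
the components of Λ along V(φ) are values of dφ up to sign, hence zero. A computation in coordinates
then finishes (`lieDerivBivector_eq_zero_of_coordinates`). -/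

noncomputable section

/-! ### Fibrewise algebra of the embeddings of A and V(A) in the vector hull -/

section HullLifting

variable {E : Type*} [NormedAddCommGroup E] [NormedSpace ℝ E]
  {M : Type*} [TopologicalSpace M] [ChartedSpace E M]
  {F : Type*} [NormedAddCommGroup F] [NormedSpace ℝ F] [FiniteDimensional ℝ F]
  {V : M → Type*} [∀ p, AddCommGroup (V p)] [∀ p, Module ℝ (V p)]
  [∀ p, TopologicalSpace (V p)] [TopologicalSpace (TotalSpace F V)]
  [FiberBundle F V] [VectorBundle ℝ F V]
  {A : M → Type*} [∀ p, AddTorsor (V p) (A p)]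
  [∀ p, TopologicalSpace (A p)] [TopologicalSpace (TotalSpace F A)] [FiberBundle F A]
  [SmoothAffineBundle E F V A]

@[simp] lemma hullPoint_apply {p : M} (a : A p) (f : AffineDual E F V A p) :
    (hullPoint E F V a f : ℝ) = f a := rfl

@[simp] lemma AffineDual.one_apply {p : M} (a : A p) : AffineDual.one E F V A p a = 1 := rfl

lemma hullVector_eq_sub {p : M} (v : V p) (a : A p) :
    hullVector E F A v = hullPoint E F V (v +ᵥ a) - hullPoint E F V a := by
  refine ContinuousLinearMap.ext fun f => ?_
  have h := AffineDual.map_vadd f v a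
  exact (eq_sub_of_add_eq h.symm :
    AffineMap.linear (k := ℝ) (V1 := V p) (V2 := ℝ) f v = f (v +ᵥ a) - f a)

lemma hullPoint_vadd {p : M} (v : V p) (a : A p) :
    hullPoint E F V (v +ᵥ a) = hullVector E F A v + hullPoint E F V a := by
  rw [hullVector_eq_sub v a, sub_add_cancel]

lemma hullVector_add {p : M} (v w : V p) :
    hullVector E F A (v + w) = hullVector E F A v + hullVector E F A w :=
  ContinuousLinearMap.ext fun f =>
    map_add (AffineMap.linear (k := ℝ) (V1 := V p) (V2 := ℝ) (P1 := A p) f) v w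

lemma hullVector_smul {p : M} (r : ℝ) (v : V p) :
    hullVector E F A (r • v) = r • hullVector E F A v :=
  ContinuousLinearMap.ext fun f =>
    map_smul (AffineMap.linear (k := ℝ) (V1 := V p) (V2 := ℝ) (P1 := A p) f) r v

lemma hullVector_apply_one {p : M} (v : V p) :
    (hullVector E F A v (AffineDual.one E F V A p) : ℝ) = 0 := rfl

variable (F) in
/-- The point of `F` represented by a functional on the affine functions `(ℓ, b)` on `F`: the
linear functionals `ℓ ↦ γ (ℓ, 0)` are evaluations at points. -/
def hullModelPoint : VectorHullModel F →L[ℝ] F :=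
  ∑ i, (ContinuousLinearMap.apply ℝ ℝ
    ((LinearMap.toContinuousLinearMap ((Module.finBasis ℝ F).coord i), 0) :
      AffineDualModel F)).smulRight (Module.finBasis ℝ F i)

/-- Expand ℓ in the dual basis. This is the reflexivity of the finite-dimensional space F, in a form
that makes the representing point a continuous linear function of γ, hence smooth in families. -/
lemma apply_hullModelPoint (γ : VectorHullModel F) (ℓ : F →L[ℝ] ℝ) :
    ℓ (hullModelPoint F γ) = γ (ℓ, 0) := by
  set B := Module.finBasis ℝ F
  have hℓ : ℓ = ∑ i, ℓ (B i) • LinearMap.toContinuousLinearMap (B.coord i) := by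
    refine ContinuousLinearMap.coe_injective (B.ext fun j => ?_)
    simp [Finsupp.single_apply]
  have h2 : ((ℓ, 0) : AffineDualModel F) =
      ∑ i, ℓ (B i) • ((LinearMap.toContinuousLinearMap (B.coord i), 0) : AffineDualModel F) := by
    refine Prod.ext ?_ ?_
    · rw [Prod.fst_sum]
      exact hℓ
    · simp [Prod.snd_sum]
  rw [h2, map_sum, hullModelPoint, sum_apply, map_sum]
  refine Finset.sum_congr rfl fun i _ => ?_
  rw [map_smul, ContinuousLinearMap.smulRight_apply, map_smul, smul_eq_mul, smul_eq_mul, mul_comm]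
  rfl

lemma hullModelPoint_eq {γ : VectorHullModel F} {x : F} (h : ∀ ℓ : F →L[ℝ] ℝ, γ (ℓ, 0) = ℓ x) :
    hullModelPoint F γ = x :=
  (SeparatingDual.eq_iff_forall_dual_eq (R := ℝ)).2 fun ℓ => by rw [apply_hullModelPoint, h]

/-- A functional on the affine functions on `A p` taking the value `1` at the constant function
`1` is the evaluation at a point. -/
lemma exists_hullPoint_eq {p : M} (Z : VectorHull E F V A p)
    (hZ : (Z (AffineDual.one E F V A p) : ℝ) = 1) : ∃ a : A p, hullPoint E F V a = Z := by
  have hp := mem_baseSet_trivializationAt F A p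
  set e := trivializationAt F A p
  let c := AffineDual.coordEquiv E V e p hp
  let γ : VectorHullModel F := LinearMap.toContinuousLinearMap
    ((Z : AffineDual E F V A p →ₗ[ℝ] ℝ) ∘ₗ c.symm.toLinearMap)
  have hγ : ∀ m, γ m = Z (c.symm m) := fun _ => rfl
  have hγ1 : γ (0, 1) = 1 := by
    have h : c.symm (0, 1) = AffineDual.one E F V A p := AffineDual.ext fun a => by
      rw [AffineDual.coordEquiv_symm_apply]
      simp
    rw [hγ, h, hZ]
  -- If f has coordinates (ℓ, b), then Z f = γ (ℓ, 0) + b γ (0, 1) = ℓ x + b with x =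
  -- `hullModelPoint F γ`; this is the value of f at the point with coordinate x.
  refine ⟨(fiberEquiv e p hp).symm (hullModelPoint F γ), ContinuousLinearMap.ext fun f => ?_⟩
  have h1 := AffineDual.coordEquiv_apply E F V A e p hp f
    ((fiberEquiv e p hp).symm (hullModelPoint F γ))
  have h2 : (e ⟨p, (fiberEquiv e p hp).symm (hullModelPoint F γ)⟩).2 = hullModelPoint F γ :=
    (fiberEquiv e p hp).apply_symm_apply _
  rw [h2, apply_hullModelPoint] at h1
  have h3 : γ (c f) = Z f := by rw [hγ, LinearEquiv.symm_apply_apply]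
  refine h1.trans (Eq.trans ?_ h3)
  have h4 : c f = ((c f).1, (0 : ℝ)) + (c f).2 • ((0, 1) : AffineDualModel F) := by
    refine Prod.ext ?_ ?_ <;> simp
  rw [h4, map_add, map_smul, hγ1]
  simp [c]

/-- The affine functions with coordinates (ℓ, 0) already separate the points of a fibre. -/
lemma hullPoint_injective (p : M) :
    Function.Injective (hullPoint E F V : A p → VectorHull E F V A p) := by
  intro a b h
  have hp := mem_baseSet_trivializationAt F A p
  refine (fiberEquiv (trivializationAt F A p) p hp).injective ?_
  refine (SeparatingDual.eq_iff_forall_dual_eq (R := ℝ)).2 fun ℓ => ?_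
  have h1 := congrArg (fun Z : VectorHull E F V A p =>
    (Z ((AffineDual.coordEquiv E V (trivializationAt F A p) p hp).symm (ℓ, 0)) : ℝ)) h
  simpa [AffineDual.coordEquiv_symm_apply] using h1

lemma hullVector_injective (p : M) :
    Function.Injective (hullVector E F A : V p → VectorHull E F V A p) := by
  intro v w h
  obtain ⟨a⟩ : Nonempty (A p) := inferInstance
  rw [hullVector_eq_sub v a, hullVector_eq_sub w a, sub_left_inj] at h
  exact vadd_right_cancel a (hullPoint_injective p h)

/-- The linear part of the change from a trivialization of `V` to one of `A` is invertible. -/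
lemma isInvertible_linearPart {e : Trivialization F (π F A)} {e' : Trivialization F (π F V)}
    [e'.IsLinear ℝ] {q : M} (hq : q ∈ e.baseSet) (hq' : q ∈ e'.baseSet) {T : F →L[ℝ] F}
    (hT : ∀ (v : V q) (a : A q), (e ⟨q, v +ᵥ a⟩).2 = T (e' ⟨q, v⟩).2 + (e ⟨q, a⟩).2) :
    T.IsInvertible := by
  obtain ⟨a⟩ : Nonempty (A q) := inferInstance
  -- If T kills the coordinate of v, then translation by v fixes a, so v = 0. Finite dimension turns
  -- injectivity into invertibility.
  have hinj : Function.Injective T := by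
    refine (injective_iff_map_eq_zero T).2 fun x hx => ?_
    obtain ⟨v, rfl⟩ := (fiberEquiv e' q hq').surjective x
    have h := hT v a
    rw [fiberEquiv_apply] at hx
    rw [hx, zero_add] at h
    have hv : v +ᵥ a = (0 : V q) +ᵥ a := by
      rw [zero_vadd]
      exact (fiberEquiv e q hq).injective h
    rw [vadd_right_cancel a hv, fiberEquiv_apply]
    exact (e'.linear ℝ hq').map_zero
  let T' : F ≃ₗ[ℝ] F := LinearEquiv.ofInjectiveEndo (T : F →ₗ[ℝ] F) hinj
  exact ⟨T'.toContinuousLinearEquiv, by ext x; rfl⟩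

/-- Two sections of an affine bundle differ by a section of its model bundle. -/
lemma Sec.exists_vadd_eq (α β : Sec E F A) : ∃ Z : Sec E F V, Z +ᵥ α = β := by
  refine ⟨⟨fun p => β p -ᵥ α p, fun p₀ => ?_⟩, ContMDiffSection.ext fun p => vsub_vadd _ _⟩
  rw [contMDiffAt_section]
  obtain ⟨T, hT, h⟩ := SmoothAffineBundle.exists_linearPart (E := E)
    (trivializationAt F A p₀) (trivializationAt F V p₀)
  have h0 : p₀ ∈ (trivializationAt F A p₀).baseSet ∩ (trivializationAt F V p₀).baseSet :=
    ⟨mem_baseSet_trivializationAt F A p₀, mem_baseSet_trivializationAt F V p₀⟩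
  have hs : (trivializationAt F A p₀).baseSet ∩ (trivializationAt F V p₀).baseSet ∈ 𝓝 p₀ :=
    ((trivializationAt F A p₀).open_baseSet.inter
      (trivializationAt F V p₀).open_baseSet).mem_nhds h0
  have hinv := fun q hq => isInvertible_linearPart (q := q)
    (And.left hq) (And.right hq) (h q hq)
  -- In coordinates β - α is T⁻¹ applied to the difference of the coordinates of β and α, and
  -- inversion of continuous linear maps is smooth at invertible ones.
  have hTi : ContMDiffAt 𝓘(ℝ, E) 𝓘(ℝ, F →L[ℝ] F) ∞ (fun q => (T q).inverse) p₀ :=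
    (hinv p₀ h0).contDiffAt_map_inverse.contMDiffAt.comp p₀ (hT.contMDiffAt hs)
  have hβ := (contMDiffAt_section (n := ∞) p₀).1 (β.contMDiff p₀)
  have hα := (contMDiffAt_section (n := ∞) p₀).1 (α.contMDiff p₀)
  refine (hTi.clm_apply (hβ.sub hα)).congr_of_eventuallyEq ?_
  filter_upwards [hs] with q hq
  have h1 := h q hq (β q -ᵥ α q) (α q)
  rw [vsub_vadd] at h1
  have h2 := (hinv q hq).inverse_apply_eq
    (x := (trivializationAt F V p₀ ⟨q, β q -ᵥ α q⟩).2)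
    (y := (trivializationAt F A p₀ ⟨q, β q⟩).2 - (trivializationAt F A p₀ ⟨q, α q⟩).2)
  exact (h2.2 (sub_eq_of_eq_add h1)).symm

lemma pairing_oneSection_hullSection (α : Sec E F A) :
    pairing (oneSection E F V A) (hullSection α) = fun _ => 1 := rfl

/-- The trivializations of A† are induced by affine trivializations of A, and the constant function
1 has the same expression in all of them. Constancy of these coordinates is what later removes the
base derivatives of φ from dι_φ and gives the vertical lift of φ constant components. -/
lemma oneSection_coord {p q : M} (hq : q ∈ (trivializationAt F A p).baseSet) :
    (oneSection E F V A).coord p q = (0, 1) := by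
  change (trivializationAt (AffineDualModel F) (AffineDual E F V A) p
    ⟨q, AffineDual.one E F V A q⟩).2 = _
  rw [AffineDual.trivializationAt_apply E F V A hq]
  refine (AffineDual.coordEquiv_eq_iff E F V A _ q hq _ _).2 fun a => ?_
  simp

lemma oneSection_coord_eventuallyEq (p : M) :
    ∀ᶠ q in 𝓝 p, (oneSection E F V A).coord p q = (0, 1) := by
  filter_upwards [(trivializationAt F A p).open_baseSet.mem_nhds
    (mem_baseSet_trivializationAt F A p)] with q hq using oneSection_coord hq

end HullLifting

/-! ### Smooth sections of A inside the sections of Â -/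

section HullSections

variable {E : Type*} [NormedAddCommGroup E] [NormedSpace ℝ E] [FiniteDimensional ℝ E]
  {M : Type*} [TopologicalSpace M] [ChartedSpace E M] [IsManifold 𝓘(ℝ, E) ∞ M] [T2Space M]
  {F : Type*} [NormedAddCommGroup F] [NormedSpace ℝ F] [FiniteDimensional ℝ F]
  {V : M → Type*} [∀ p, AddCommGroup (V p)] [∀ p, Module ℝ (V p)]
  [∀ p, TopologicalSpace (V p)] [TopologicalSpace (TotalSpace F V)]
  [FiberBundle F V] [VectorBundle ℝ F V]
  {A : M → Type*} [∀ p, AddTorsor (V p) (A p)]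
  [∀ p, TopologicalSpace (A p)] [TopologicalSpace (TotalSpace F A)] [FiberBundle F A]
  [SmoothAffineBundle E F V A]

/-- The local coordinates of the evaluation at a point of `A`. -/
lemma hullPoint_coord {p q : M} (hq : q ∈ (trivializationAt F A p).baseSet) (a : A q)
    (m : AffineDualModel F) :
    (trivializationAt (VectorHullModel F) (VectorHull E F V A) p ⟨q, hullPoint E F V a⟩).2 m =
      m.1 (trivializationAt F A p ⟨q, a⟩).2 + m.2 := by
  have h1 := dual_apply_eq (F := AffineDualModel F) (W := AffineDual E F V A) (p := p) (q := q) hq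
    (hullPoint E F V a) ((AffineDual.coordEquiv E V (trivializationAt F A p) q hq).symm m)
  rw [AffineDual.trivializationAt_apply E F V A hq, LinearEquiv.apply_symm_apply] at h1
  exact h1.symm

/-- A section of `Â` on which `1_A` is equal to `1` is a section of `A`. -/
lemma exists_hullSection_eq (Z : Sec E (VectorHullModel F) (VectorHull E F V A))
    (hZ : ∀ p, pairing (oneSection E F V A) Z p = 1) : ∃ β : Sec E F A, hullSection β = Z := by
  choose b hb using fun p => exists_hullPoint_eq (Z p) (hZ p)
  refine ⟨⟨b, fun p₀ => ?_⟩, ContMDiffSection.ext hb⟩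
  rw [contMDiffAt_section]
  have hZs := (contMDiffAt_section (n := ∞) p₀).1 (Z.contMDiff p₀)
  -- The points b p are chosen fibre by fibre; they vary smoothly because their coordinate is a
  -- fixed linear map applied to the coordinate of Z.
  have hR : ContMDiff 𝓘(ℝ, VectorHullModel F) 𝓘(ℝ, F) ∞ (hullModelPoint F) :=
    ContinuousLinearMap.contMDiff _
  refine (hR.contMDiffAt.comp p₀ hZs).congr_of_eventuallyEq ?_
  filter_upwards [(trivializationAt F A p₀).open_baseSet.mem_nhds
    (mem_baseSet_trivializationAt F A p₀)] with q hq
  refine (hullModelPoint_eq fun ℓ => ?_).symm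
  change (trivializationAt (VectorHullModel F) (VectorHull E F V A) p₀ ⟨q, Z q⟩).2 (ℓ, 0) = _
  rw [← hb q, hullPoint_coord hq]
  simp

variable {W : M → Type*} [∀ p, AddCommGroup (W p)] [∀ p, Module ℝ (W p)]
  [∀ p, TopologicalSpace (W p)] [TopologicalSpace (TotalSpace F W)]
  [FiberBundle F W] [VectorBundle ℝ F W] [ContMDiffVectorBundle ∞ F W 𝓘(ℝ, E)]

lemma contMDiff_pairing (μ : Sec E F W) (X : Sec E (F →L[ℝ] ℝ) (DualBundle W)) :
    ContMDiff 𝓘(ℝ, E) 𝓘(ℝ, ℝ) ∞ (pairing μ X) := by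
  intro p
  have h1 := (contMDiffAt_section (n := ∞) p).1 (μ.contMDiff p)
  have h2 := (contMDiffAt_section (n := ∞) p).1 (X.contMDiff p)
  refine (h2.clm_apply h1).congr_of_eventuallyEq ?_
  filter_upwards [(trivializationAt F W p).open_baseSet.mem_nhds
    (mem_baseSet_trivializationAt F W p)] with q hq using dual_apply_eq hq _ _

/-- The pairing of two sections as a smooth function. -/
def smoothPairing (μ : Sec E F W) (X : Sec E (F →L[ℝ] ℝ) (DualBundle W)) : C^∞⟮𝓘(ℝ, E), M; ℝ⟯ :=
  ⟨pairing μ X, contMDiff_pairing μ X⟩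

/-- Given a section `α` of `A`, a section `X` of `Â` is `(⟨1_A, X⟩ - 1) α + β` for a section `β`
of `A`. -/
lemma exists_eq_fsmul_hullSection_add (α : Sec E F A)
    (X : Sec E (VectorHullModel F) (VectorHull E F V A)) : ∃ β : Sec E F A,
      X = (hullSection α).fsmul (smoothPairing (oneSection E F V A) X - 1) + hullSection β := by
  obtain ⟨β, hβ⟩ := exists_hullSection_eq
    (X - (hullSection α).fsmul (smoothPairing (oneSection E F V A) X - 1)) fun p => by
      change pairing (oneSection E F V A) X p -
        (pairing (oneSection E F V A) X p - 1) * pairing (oneSection E F V A) (hullSection α) p = 1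
      rw [pairing_oneSection_hullSection]
      ring
  exact ⟨β, by rw [hβ]; abel⟩

variable (E F V A) in
/-- Over a σ-compact Hausdorff manifold, `Â` has a smooth section on which `1_A` is equal to `1`,
that is, the affine bundle `A` has a smooth section. -/
lemma exists_pairing_oneSection_eq_one [SigmaCompactSpace M] :
    ∃ Z : Sec E (VectorHullModel F) (VectorHull E F V A),
      ∀ p, pairing (oneSection E F V A) Z p = 1 := by
  -- The condition of pairing to 1 with the constant function 1 is convex on each fibre, so local
  -- solutions are glued by a partition of unity.
  exact exists_contMDiffSection_forall_mem_convex_of_local 𝓘(ℝ, E) (n := ⊤)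
    (F_fiber := VectorHullModel F) (VectorHull E F V A)
    (fun p => {Z | (Z (AffineDual.one E F V A p) : ℝ) = 1})
    (fun p Z hZ Z' hZ' a b _ _ hab => by
      change a * (Z (AffineDual.one E F V A p) : ℝ) + b * (Z' (AffineDual.one E F V A p) : ℝ) = 1
      rw [hZ, hZ', mul_one, mul_one, hab])
    (fun p => by
      obtain ⟨S, hS, -⟩ := exists_frame (E := E) (F := VectorHullModel F)
        (V := VectorHull E F V A) p
      -- The functional (ℓ, b) ↦ b is evaluation at the origin of F. The local solution is therefore
      -- the zero section of A in the trivialization, and it takes the value 1 on (0, 1).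
      have h := hS (ContinuousLinearMap.snd ℝ _ _)
      refine ⟨_, Filter.inter_mem h ((trivializationAt F A p).open_baseSet.mem_nhds
        (mem_baseSet_trivializationAt F A p)), S (ContinuousLinearMap.snd ℝ _ _),
        (S _).contMDiff.contMDiffOn, fun q hq => ?_⟩
      have h1 := dual_apply_eq (F := AffineDualModel F) (W := AffineDual E F V A) hq.2
        (S (ContinuousLinearMap.snd ℝ _ _) q) (oneSection E F V A q)
      refine h1.trans ?_
      have h2 : (S (ContinuousLinearMap.snd ℝ _ _)).coord p q = _ := hq.1
      have h3 := oneSection_coord (E := E) (V := V) hq.2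
      unfold Sec.coord at h2 h3
      rw [h2, h3]
      rfl)

/-- Through every point of `A` there is a smooth section. -/
lemma exists_affine_section_through [SigmaCompactSpace M] {p : M} (a : A p) :
    ∃ β : Sec E F A, hullSection β p = hullPoint E F V a := by
  obtain ⟨Z, hZ⟩ := exists_pairing_oneSection_eq_one E F V A
  obtain ⟨α, -⟩ := exists_hullSection_eq Z hZ
  obtain ⟨S, hS, -⟩ := exists_frame (E := E) (F := VectorHullModel F) (V := VectorHull E F V A) p
  -- Extend the given vector to a section X of Â. In the decomposition of X the coefficient of α is
  -- ⟨1_A, X⟩ - 1, which vanishes at p, so β takes the prescribed value there.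
  set X := S (trivializationAt (VectorHullModel F) (VectorHull E F V A) p
    ⟨p, hullPoint E F V a⟩).2
  have hX : X p = hullPoint E F V a := coord_injective
    (F := VectorHullModel F) (V := VectorHull E F V A) (hS _).self_of_nhds
  obtain ⟨β, hβ⟩ := exists_eq_fsmul_hullSection_add α X
  refine ⟨β, ?_⟩
  have h1 := congrArg (fun Y => Y p) hβ
  have h2 : X p = (pairing (oneSection E F V A) X p - 1) • hullPoint E F V (α p) +
    hullPoint E F V (β p) := h1
  have h3 : pairing (oneSection E F V A) X p = 1 := by
    rw [pairing, hX]
    rfl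
  rw [h3, sub_self, zero_smul, zero_add, hX] at h2
  exact h2.symm

end HullSections

/-! ### Tensoriality of the algebroid differential, and functions linear on fibres -/

section ExteriorDerivative

variable {E : Type*} [NormedAddCommGroup E] [NormedSpace ℝ E] [FiniteDimensional ℝ E]
  {M : Type*} [TopologicalSpace M] [ChartedSpace E M] [IsManifold 𝓘(ℝ, E) ∞ M] [T2Space M]
  {F : Type*} [NormedAddCommGroup F] [NormedSpace ℝ F] [FiniteDimensional ℝ F]
  {W : M → Type*} [∀ p, AddCommGroup (W p)] [∀ p, Module ℝ (W p)]
  [∀ p, TopologicalSpace (W p)] [TopologicalSpace (TotalSpace F W)]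
  [FiberBundle F W] [VectorBundle ℝ F W] [ContMDiffVectorBundle ∞ F W 𝓘(ℝ, E)]

section Differential

variable {B H N : Type*} [NormedAddCommGroup B] [NormedSpace ℝ B] [TopologicalSpace H]
  {I : ModelWithCorners ℝ B H} [TopologicalSpace N] [ChartedSpace H N] {f g : N → ℝ} {x : N}

lemma differential_add (hf : MDifferentiableAt I 𝓘(ℝ, ℝ) f x)
    (hg : MDifferentiableAt I 𝓘(ℝ, ℝ) g x) :
    differential I (fun y => f y + g y) x = differential I f x + differential I g x :=
  (hf.hasMFDerivAt.add hg.hasMFDerivAt).mfderiv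

lemma differential_mul (hf : MDifferentiableAt I 𝓘(ℝ, ℝ) f x)
    (hg : MDifferentiableAt I 𝓘(ℝ, ℝ) g x) (v : TangentSpace I x) :
    differential I (fun y => f y * g y) x v =
      f x * differential I g x v + g x * differential I f x v :=
  congrArg (fun l : TangentSpace I x →L[ℝ] ℝ => l v) (hf.hasMFDerivAt.mul hg.hasMFDerivAt).mfderiv

@[simp] lemma differential_const (c : ℝ) : differential I (fun _ : N => c) x = 0 :=
  mfderiv_const

lemma differential_congr (h : f =ᶠ[𝓝 x] g) : differential I f x = differential I g x :=
  h.mfderiv_eq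

end Differential

variable (L : LieAlgebroid E (F →L[ℝ] ℝ) (DualBundle W))

lemma mdifferentiableAt_pairing (μ : Sec E F W) (X : Sec E (F →L[ℝ] ℝ) (DualBundle W)) (p : M) :
    MDifferentiableAt 𝓘(ℝ, E) 𝓘(ℝ, ℝ) (pairing μ X) p :=
  (contMDiff_pairing μ X).mdifferentiable (by simp) p

lemma extDeriv₁_swap (μ : Sec E F W) (X Y : Sec E (F →L[ℝ] ℝ) (DualBundle W)) (p : M) :
    extDeriv₁ L μ X Y p = -extDeriv₁ L μ Y X p := by
  have h : pairing μ (L.bracket X Y) p = -pairing μ (L.bracket Y X) p := by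
    rw [L.bracket_skew X Y]
    rfl
  rw [extDeriv₁, extDeriv₁, h]
  ring

lemma extDeriv₁_add_right (μ : Sec E F W) (X Y Z : Sec E (F →L[ℝ] ℝ) (DualBundle W)) (p : M) :
    extDeriv₁ L μ X (Y + Z) p = extDeriv₁ L μ X Y p + extDeriv₁ L μ X Z p := by
  have h1 : differential 𝓘(ℝ, E) (pairing μ (Y + Z)) p =
      differential 𝓘(ℝ, E) (pairing μ Y) p + differential 𝓘(ℝ, E) (pairing μ Z) p :=
    differential_add (mdifferentiableAt_pairing μ Y p) (mdifferentiableAt_pairing μ Z p)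
  have h2 : pairing μ (L.bracket X (Y + Z)) p =
      pairing μ (L.bracket X Y) p + pairing μ (L.bracket X Z) p := by
    rw [map_add]
    rfl
  have h3 : L.anchor p ((Y + Z) p) = L.anchor p (Y p) + L.anchor p (Z p) :=
    map_add (L.anchor p) (Y p) (Z p)
  simp only [extDeriv₁, h1, h2, h3]
  simp only [map_add, _root_.add_apply]
  ring

/-- The term ρ(X)(f) ⟨μ, Y⟩ appears once from differentiating f ⟨μ, Y⟩ and once from the Leibniz
rule for the bracket, with opposite signs. -/
lemma extDeriv₁_fsmul_right (μ : Sec E F W) (X Y : Sec E (F →L[ℝ] ℝ) (DualBundle W))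
    (f : C^∞⟮𝓘(ℝ, E), M; ℝ⟯) (p : M) :
    extDeriv₁ L μ X (Y.fsmul f) p = f p * extDeriv₁ L μ X Y p := by
  have h1 : ∀ v, differential 𝓘(ℝ, E) (pairing μ (Y.fsmul f)) p v =
      f p * differential 𝓘(ℝ, E) (pairing μ Y) p v + pairing μ Y p * differential 𝓘(ℝ, E) f p v :=
    differential_mul (f.contMDiff.mdifferentiable (by simp) p) (mdifferentiableAt_pairing μ Y p)
  have h2 : pairing μ (L.bracket X (Y.fsmul f)) p =
      f p * pairing μ (L.bracket X Y) p +
        differential 𝓘(ℝ, E) f p (L.anchor p (X p)) * pairing μ Y p :=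
    congrArg (fun Z : DualBundle W p => (Z (μ p) : ℝ)) (L.leibniz X f Y p)
  have h3 : L.anchor p (Y.fsmul f p) = f p • L.anchor p (Y p) :=
    map_smul (L.anchor p) (f p) (Y p)
  simp only [extDeriv₁, h1, h2, h3, map_smul, smul_eq_mul]
  ring

/-- When μ has constant coordinates, ι_μ depends only on the fibre coordinate γ, as γ ↦ γ c. For μ =
1_A this identifies dι_φ with evaluation at (0, 1). -/
lemma differential_linearFunDual_of_coord_eventuallyEq (μ : Sec E F W) {c : F}
    (e : TotalSpace (F →L[ℝ] ℝ) (DualBundle W)) (h : ∀ᶠ q in 𝓝 e.1, μ.coord e.1 q = c)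
    (v : E × (F →L[ℝ] ℝ)) :
    differential (𝓘(ℝ, E).prod 𝓘(ℝ, F →L[ℝ] ℝ)) (linearFunDual μ) e v = v.2 c := by
  have h1 : μ.dcoord e.1 = 0 := by
    have h2 : μ.coord e.1 =ᶠ[𝓝 e.1] fun _ => c := h
    unfold Sec.dcoord
    rw [h2.mfderiv_eq]
    exact mfderiv_const
  rw [differential_linearFunDual, h1, h.self_of_nhds]
  simp

lemma completeLift_linear (X : Sec E (F →L[ℝ] ℝ) (DualBundle W)) (μ : Sec E F W)
    (e : TotalSpace (F →L[ℝ] ℝ) (DualBundle W)) (Y : Sec E (F →L[ℝ] ℝ) (DualBundle W))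
    (hY : Y e.1 = e.2) :
    differential (𝓘(ℝ, E).prod 𝓘(ℝ, F →L[ℝ] ℝ)) (linearFunDual μ) e (completeLift L X e) =
      lieDeriv₁ L X μ Y e.1 :=
  (existsUnique_isCompleteLiftAt L X e).choose_spec.1.linear μ Y hY

end ExteriorDerivative

/-! ### Derivatives of bundle morphisms that are affine in trivializations -/

section FiberBundleMaps

variable {E : Type*} [NormedAddCommGroup E] [NormedSpace ℝ E]
  {M : Type*} [TopologicalSpace M] [ChartedSpace E M]
  {F : Type*} [NormedAddCommGroup F] [NormedSpace ℝ F]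
  {G : Type*} [NormedAddCommGroup G] [NormedSpace ℝ G]
  {A : M → Type*} [∀ p, TopologicalSpace (A p)] [TopologicalSpace (TotalSpace F A)]
  [FiberBundle F A]
  {B : M → Type*} [∀ p, TopologicalSpace (B p)] [TopologicalSpace (TotalSpace G B)]
  [FiberBundle G B]

/-- The derivative of a morphism of fibre bundles over the identity which is affine, with constant
coefficients, in the preferred trivializations. -/
lemma hasMFDerivAt_of_affine_coord {Φ : TotalSpace F A → TotalSpace G B} (hΦ : ∀ z, (Φ z).1 = z.1)
    (a : TotalSpace F A) (hc : ContinuousAt Φ a) (J : F →L[ℝ] G) (c : G)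
    (h : ∀ z, z.1 ∈ (trivializationAt F A a.1).baseSet →
      z.1 ∈ (trivializationAt G B (Φ a).1).baseSet ∧
        (trivializationAt G B (Φ a).1 (Φ z)).2 = J (trivializationAt F A a.1 z).2 + c) :
    HasMFDerivAt (𝓘(ℝ, E).prod 𝓘(ℝ, F)) (𝓘(ℝ, E).prod 𝓘(ℝ, G)) Φ a
      ((ContinuousLinearMap.fst ℝ E F).prod (J ∘L ContinuousLinearMap.snd ℝ E F) :
        E × F →L[ℝ] E × G) := by
  -- The charts of a total space are built from a trivialization and a chart of M, and Φ covers the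
  -- identity; so Φ reads (x, y) ↦ (x, J y + c) on the whole chart.
  have key : ∀ y ∈ (extChartAt (𝓘(ℝ, E).prod 𝓘(ℝ, F)) a).target,
      writtenInExtChartAt (𝓘(ℝ, E).prod 𝓘(ℝ, F)) (𝓘(ℝ, E).prod 𝓘(ℝ, G)) a Φ y =
        (y.1, J y.2 + c) := by
    intro y hy
    rw [FiberBundle.extChartAt_target] at hy
    have hsymm : (extChartAt (𝓘(ℝ, E).prod 𝓘(ℝ, F)) a).symm y =
        (trivializationAt F A a.1).toOpenPartialHomeomorph.symm
          ((extChartAt 𝓘(ℝ, E) a.1).symm y.1, y.2) := by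
      rw [FiberBundle.extChartAt]
      rfl
    have h1 : ((extChartAt (𝓘(ℝ, E).prod 𝓘(ℝ, F)) a).symm y).proj =
        (extChartAt 𝓘(ℝ, E) a.1).symm y.1 := by
      rw [hsymm]
      exact (trivializationAt F A a.1).proj_symm_apply' hy.1.2
    have h2 : (trivializationAt F A a.1 ((extChartAt (𝓘(ℝ, E).prod 𝓘(ℝ, F)) a).symm y)).2 =
        y.2 := by
      rw [hsymm]
      exact congrArg Prod.snd ((trivializationAt F A a.1).apply_symm_apply' hy.1.2)
    rw [writtenInExtChartAt, Function.comp_apply, Function.comp_apply]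
    generalize (extChartAt (𝓘(ℝ, E).prod 𝓘(ℝ, F)) a).symm y = z at h1 h2
    rw [FiberBundle.extChartAt]
    have hz : z.1 ∈ (trivializationAt F A a.1).baseSet := by
      rw [h1]
      exact hy.1.2
    obtain ⟨hz1, hz2⟩ := h z hz
    refine Prod.ext ?_ ?_
    · change extChartAt 𝓘(ℝ, E) (Φ a).1 (trivializationAt G B (Φ a).1 (Φ z)).1 = y.1
      rw [Trivialization.coe_fst' _ (by rw [hΦ z]; exact hz1), hΦ z, hΦ a, h1]
      exact (extChartAt 𝓘(ℝ, E) a.1).right_inv hy.1.1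
    · rw [h2] at hz2
      exact hz2
  refine ⟨hc, ?_⟩
  have h1 : HasFDerivAt (fun y : E × F => (y.1, J y.2 + c))
      ((ContinuousLinearMap.fst ℝ E F).prod (J ∘L ContinuousLinearMap.snd ℝ E F))
      (extChartAt (𝓘(ℝ, E).prod 𝓘(ℝ, F)) a a) :=
    hasFDerivAt_fst.prodMk ((J.hasFDerivAt.comp _ hasFDerivAt_snd).add_const _)
  refine h1.hasFDerivWithinAt.congr_of_eventuallyEq ?_ (key _ (mem_extChartAt_target a))
  filter_upwards [extChartAt_target_mem_nhdsWithin (I := 𝓘(ℝ, E).prod 𝓘(ℝ, F)) a] with y hy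
    using key y hy

end FiberBundleMaps

/-! ### Closedness of 1_A, the induced Lie affgebroid, and tangency of complete lifts -/

section Affgebroid

variable {E : Type*} [NormedAddCommGroup E] [NormedSpace ℝ E] [FiniteDimensional ℝ E]
  {M : Type*} [TopologicalSpace M] [ChartedSpace E M] [IsManifold 𝓘(ℝ, E) ∞ M] [T2Space M]
  {F : Type*} [NormedAddCommGroup F] [NormedSpace ℝ F] [FiniteDimensional ℝ F]
  {V : M → Type*} [∀ p, AddCommGroup (V p)] [∀ p, Module ℝ (V p)]
  [∀ p, TopologicalSpace (V p)] [TopologicalSpace (TotalSpace F V)]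
  [FiberBundle F V] [VectorBundle ℝ F V]
  {A : M → Type*} [∀ p, AddTorsor (V p) (A p)]
  [∀ p, TopologicalSpace (A p)] [TopologicalSpace (TotalSpace F A)] [FiberBundle F A]
  [SmoothAffineBundle E F V A]
  (L : LieAlgebroid E (VectorHullModel F) (VectorHull E F V A))

lemma extDeriv₁_oneSection_hullSection (α β : Sec E F A) (p : M) :
    extDeriv₁ L (oneSection E F V A) (hullSection α) (hullSection β) p =
      -pairing (oneSection E F V A) (L.bracket (hullSection α) (hullSection β)) p := by
  simp [extDeriv₁, pairing_oneSection_hullSection]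

/-- The 1-form `1_A` is closed if and only if the bracket of sections of `A` is in `V(A)`. -/
lemma extDeriv₁_oneSection_eq_zero_iff [SigmaCompactSpace M] :
    (∀ X Y p, extDeriv₁ L (oneSection E F V A) X Y p = 0) ↔
      ∀ (α β : Sec E F A) (p : M),
        pairing (oneSection E F V A) (L.bracket (hullSection α) (hullSection β)) p = 0 := by
  refine ⟨fun h α β p => ?_, fun h X Y p => ?_⟩
  · rw [← neg_eq_zero, ← extDeriv₁_oneSection_hullSection, h]
  · obtain ⟨Z, hZ⟩ := exists_pairing_oneSection_eq_one E F V A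
    obtain ⟨α, -⟩ := exists_hullSection_eq Z hZ
    have h0 : ∀ β γ : Sec E F A,
        extDeriv₁ L (oneSection E F V A) (hullSection β) (hullSection γ) p = 0 := fun β γ => by
      rw [extDeriv₁_oneSection_hullSection, h, neg_zero]
    -- Tensoriality is used in the second argument first; skew-symmetry then carries it over to the
    -- first argument.
    have h1 : ∀ (β : Sec E F A) (Y : Sec E (VectorHullModel F) (VectorHull E F V A)),
        extDeriv₁ L (oneSection E F V A) (hullSection β) Y p = 0 := fun β Y => by
      obtain ⟨γ, hγ⟩ := exists_eq_fsmul_hullSection_add α Y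
      rw [hγ, extDeriv₁_add_right, extDeriv₁_fsmul_right, h0, h0, mul_zero, add_zero]
    obtain ⟨β, hβ⟩ := exists_eq_fsmul_hullSection_add α X
    rw [extDeriv₁_swap, hβ, extDeriv₁_add_right, extDeriv₁_fsmul_right, extDeriv₁_swap,
      extDeriv₁_swap L _ Y (hullSection β), h1, h1, neg_zero, mul_zero, add_zero, neg_zero]

/-- A section of `Â` on which `1_A` vanishes is a section of `V(A)`. -/
lemma exists_hullVector_eq [SigmaCompactSpace M]
    (X : Sec E (VectorHullModel F) (VectorHull E F V A))
    (hX : ∀ p, pairing (oneSection E F V A) X p = 0) :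
    ∃ Z : Sec E F V, ∀ p, hullVector E F A (Z p) = X p := by
  obtain ⟨Z₁, hZ₁⟩ := exists_pairing_oneSection_eq_one E F V A
  obtain ⟨α, -⟩ := exists_hullSection_eq Z₁ hZ₁
  -- Adding α moves X from the level set 0 of ι_φ to the level set 1. The result is a section β of
  -- A, and the required section of V(A) is β - α.
  obtain ⟨β, hβ⟩ := exists_hullSection_eq (X + hullSection α) fun p => by
    change pairing (oneSection E F V A) X p + 1 = 1
    rw [hX, zero_add]
  obtain ⟨Z, rfl⟩ := Sec.exists_vadd_eq (V := V) α β
  refine ⟨Z, fun p => ?_⟩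
  rw [hullVector_eq_sub _ (α p)]
  have h : hullPoint E F V (Z p +ᵥ α p) = X p + hullPoint E F V (α p) :=
    congrArg (fun Y => Y p) hβ
  rw [h, add_sub_cancel_right]

variable (E F V A) in
-- In the induced trivializations the fibre part is x ↦ ((ℓ, b) ↦ ℓ x + b), which is affine in x and
-- independent of the base point.
lemma contMDiff_hullMap : ContMDiff (𝓘(ℝ, E).prod 𝓘(ℝ, F)) (𝓘(ℝ, E).prod 𝓘(ℝ, VectorHullModel F))
    ∞ (hullMap E F V A) := by
  intro a
  have hid : ContMDiffAt (𝓘(ℝ, E).prod 𝓘(ℝ, F)) (𝓘(ℝ, E).prod 𝓘(ℝ, F)) ∞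
    (id : TotalSpace F A → TotalSpace F A) a := contMDiffAt_id
  rw [contMDiffAt_totalSpace] at hid ⊢
  refine ⟨hid.1, ?_⟩
  have hA : ContMDiff 𝓘(ℝ, F) 𝓘(ℝ, (F →L[ℝ] ℝ) →L[ℝ] ℝ) ∞ fun x : F =>
      (ContinuousLinearMap.apply ℝ ℝ x : (F →L[ℝ] ℝ) →L[ℝ] ℝ) := by
    rw [contMDiff_iff_contDiff]
    exact ContinuousLinearMap.contDiff _
  have h : ContMDiffAt (𝓘(ℝ, E).prod 𝓘(ℝ, F)) 𝓘(ℝ, VectorHullModel F) ∞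
      (fun b : TotalSpace F A => (ContinuousLinearMap.apply ℝ ℝ (trivializationAt F A a.1 b).2 :
          (F →L[ℝ] ℝ) →L[ℝ] ℝ) ∘L ContinuousLinearMap.fst ℝ _ _ +
        ContinuousLinearMap.snd ℝ (F →L[ℝ] ℝ) ℝ) a :=
    ((hA.contMDiffAt.comp a hid.2).clm_comp contMDiffAt_const).add contMDiffAt_const
  refine h.congr_of_eventuallyEq ?_
  have : π F A ⁻¹' (trivializationAt F A a.1).baseSet ∈ 𝓝 a :=
    (FiberBundle.continuous_proj F A).continuousAt.preimage_mem_nhds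
      ((trivializationAt F A a.1).open_baseSet.mem_nhds (mem_baseSet_trivializationAt F A a.1))
  filter_upwards [this] with b hb
  exact ContinuousLinearMap.ext fun m => hullPoint_coord hb b.2 m

variable (E F A) in
/-- The embedding `V(A) ↪ Â` on fibres as a linear map. -/
def hullVectorLinear (p : M) : V p →ₗ[ℝ] VectorHull E F V A p where
  toFun := hullVector E F A
  map_add' := hullVector_add
  map_smul' := hullVector_smul

/-! ### The Lie affgebroid axioms pulled back from Â -/

section InducedBracket

variable {L} {b : Sec E F A → Sec E F A → Sec E F V}

/-- A section of `V(A)` as a section of `Â`, the difference of two sections of `A`. -/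
def hullVectorSection (α : Sec E F A) (X : Sec E F V) :
    Sec E (VectorHullModel F) (VectorHull E F V A) :=
  hullSection (X +ᵥ α) - hullSection α

lemma hullVectorSection_apply (α : Sec E F A) (X : Sec E F V) (p : M) :
    hullVectorSection α X p = hullVectorLinear E F A p (X p) :=
  (hullVector_eq_sub (X p) (α p)).symm

lemma bracket_hullSection_self (α : Sec E F A) (p : M) :
    L.bracket (hullSection α) (hullSection α) p = 0 := by
  have h : L.bracket (hullSection α) (hullSection α) p =
      -(L.bracket (hullSection α) (hullSection α) p) :=
    congrArg (fun Y => Y p) (L.bracket_skew (hullSection α) (hullSection α))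
  have h1 : (2 : ℝ) • L.bracket (hullSection α) (hullSection α) p = 0 := by
    rw [two_smul]
    exact eq_neg_iff_add_eq_zero.1 h
  exact (smul_eq_zero.1 h1).resolve_left two_ne_zero

/-- Any section Y of Â representing X is allowed, because the uses differ: the Jacobi identity takes
Y to be a bracket, the Leibniz rule a multiple by a function, and linearity a sum or a real
multiple. -/
lemma hullVector_bracket_vadd (hb : ∀ α β p,
      hullVectorLinear E F A p (b α β p) = L.bracket (hullSection α) (hullSection β) p)
    (α β : Sec E F A) (X : Sec E F V)
    (Y : Sec E (VectorHullModel F) (VectorHull E F V A))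
    (hXY : ∀ p, hullVectorLinear E F A p (X p) = Y p) (p : M) :
    hullVectorLinear E F A p (b α (X +ᵥ β) p) =
      L.bracket (hullSection α) Y p + L.bracket (hullSection α) (hullSection β) p := by
  have h : hullSection (X +ᵥ β) = Y + hullSection β :=
    ContMDiffSection.ext fun q => (hullPoint_vadd (X q) (β q)).trans
      (congrArg (· + hullPoint E F V (β q)) (hXY q))
  rw [hb, h, map_add]
  rfl

lemma hullVector_bracket_vadd_self (hb : ∀ α β p,
      hullVectorLinear E F A p (b α β p) = L.bracket (hullSection α) (hullSection β) p)
    (α : Sec E F A) (X : Sec E F V)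
    (Y : Sec E (VectorHullModel F) (VectorHull E F V A))
    (hXY : ∀ p, hullVectorLinear E F A p (X p) = Y p) (p : M) :
    hullVectorLinear E F A p (b α (X +ᵥ α) p) = L.bracket (hullSection α) Y p := by
  rw [hullVector_bracket_vadd hb α α X Y hXY, bracket_hullSection_self, add_zero]

lemma hullVector_bracket_vadd_self' (hb : ∀ α β p,
      hullVectorLinear E F A p (b α β p) = L.bracket (hullSection α) (hullSection β) p)
    (α : Sec E F A) (X : Sec E F V) (p : M) :
    hullVectorLinear E F A p (b α (X +ᵥ α) p) =
      L.bracket (hullSection α) (hullVectorSection α X) p :=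
  hullVector_bracket_vadd_self hb α X _ (fun q => (hullVectorSection_apply α X q).symm) p

lemma induced_bracket_skew (hb : ∀ α β p,
      hullVectorLinear E F A p (b α β p) = L.bracket (hullSection α) (hullSection β) p)
    (α β : Sec E F A) : b α β = -b β α :=
  ContMDiffSection.ext fun p => hullVector_injective (E := E) (F := F) (A := A) p <|
    (hb α β p).trans <| by
      rw [L.bracket_skew]
      exact (congrArg Neg.neg (hb β α p)).symm.trans
        (map_neg (hullVectorLinear E F A p) (b β α p)).symm

variable
  (hb : ∀ α β p, hullVectorLinear E F A p (b α β p) = L.bracket (hullSection α) (hullSection β) p)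

/-- The linear part of the bracket with a section of `A`. -/
def inducedLinPart (α : Sec E F A) : Sec E F V →ₗ[ℝ] Sec E F V where
  -- Since b α α = 0, the value of the affine map b α at X + α is its linear part at X.
  toFun X := b α (X +ᵥ α)
  map_add' X Y := ContMDiffSection.ext fun p => hullVector_injective (E := E) (F := F) (A := A) p <|
    (hullVector_bracket_vadd_self hb α (X + Y) (hullVectorSection α X + hullVectorSection α Y)
      (fun q => (map_add (hullVectorLinear E F A q) (X q) (Y q)).trans (congrArg₂ (· + ·)
        (hullVectorSection_apply α X q).symm (hullVectorSection_apply α Y q).symm)) p).trans <| by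
      rw [map_add]
      exact (congrArg₂ (· + ·) (hullVector_bracket_vadd_self' hb α X p)
        (hullVector_bracket_vadd_self' hb α Y p)).symm.trans
        (map_add (hullVectorLinear E F A p) _ _).symm
  map_smul' r X := ContMDiffSection.ext fun p => hullVector_injective (E := E) (F := F) (A := A) p <|
    (hullVector_bracket_vadd_self hb α (r • X) (r • hullVectorSection α X)
      (fun q => (map_smul (hullVectorLinear E F A q) r (X q)).trans (congrArg (r • ·)
        (hullVectorSection_apply α X q).symm)) p).trans <| by
      rw [map_smul]
      exact (congrArg (r • ·) (hullVector_bracket_vadd_self' hb α X p)).symm.trans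
        (map_smul (hullVectorLinear E F A p) r _).symm

lemma hullVector_inducedLinPart (α : Sec E F A) (X : Sec E F V)
    (Y : Sec E (VectorHullModel F) (VectorHull E F V A))
    (hXY : ∀ p, hullVectorLinear E F A p (X p) = Y p) (p : M) :
    hullVectorLinear E F A p (inducedLinPart hb α X p) = L.bracket (hullSection α) Y p :=
  hullVector_bracket_vadd_self hb α X Y hXY p

variable (L) in
/-- The anchor of `Â` restricted to a fibre of `A`. -/
def inducedAnchor (p : M) : A p →ᵃ[ℝ] TangentSpace 𝓘(ℝ, E) p where
  toFun a := L.anchor p (hullPoint E F V a)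
  linear := L.anchor p ∘ₗ hullVectorLinear E F A p
  map_vadd' a v := (congrArg (L.anchor p) (hullPoint_vadd v a)).trans (map_add (L.anchor p) _ _)

/-- In Â each linear part becomes a bracket with a section of A, and the identity is the Jacobi
identity for three sections of A. -/
lemma induced_jacobi (α β γ : Sec E F A) :
    inducedLinPart hb α (b β γ) + inducedLinPart hb β (b γ α) + inducedLinPart hb γ (b α β) = 0 :=
  ContMDiffSection.ext fun p => hullVector_injective (E := E) (F := F) (A := A) p <| by
    have h := congrArg (fun Y => Y p)
      (L.jacobi (hullSection α) (hullSection β) (hullSection γ))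
    refine Eq.trans ?_ (h.trans (map_zero (hullVectorLinear E F A p)).symm)
    refine (map_add (hullVectorLinear E F A p) _ _).trans (congrArg₂ (· + ·)
      ((map_add (hullVectorLinear E F A p) _ _).trans (congrArg₂ (· + ·) ?_ ?_)) ?_)
    · exact hullVector_inducedLinPart hb α _ _ (hb β γ) p
    · exact hullVector_inducedLinPart hb β _ _ (hb γ α) p
    · exact hullVector_inducedLinPart hb γ _ _ (hb α β) p

lemma induced_leibniz (α : Sec E F A) (f : C^∞⟮𝓘(ℝ, E), M; ℝ⟯) (X : Sec E F V) (p : M) :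
    inducedLinPart hb α (X.fsmul f) p = f p • inducedLinPart hb α X p +
      differential 𝓘(ℝ, E) f p (inducedAnchor L p (α p)) • X p := by
  refine hullVector_injective (E := E) (F := F) (A := A) p ?_
  refine (hullVector_inducedLinPart hb α (X.fsmul f) ((hullVectorSection α X).fsmul f)
    -- The Leibniz rule in Â applies because the embedding V(A) → Â commutes with multiplication by
    -- f; its anchor term is already the anchor restricted to A.
    (fun q => (map_smul (hullVectorLinear E F A q) (f q) (X q)).trans (congrArg (f q • ·)
      (hullVectorSection_apply α X q).symm)) p).trans ((L.leibniz _ f _ p).trans ?_)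
  refine Eq.trans ?_ (map_add (hullVectorLinear E F A p) _ _).symm
  refine congrArg₂ (· + ·) ?_ ?_
  · exact (congrArg (f p • ·) (hullVector_bracket_vadd_self' hb α X p)).symm.trans
      (map_smul (hullVectorLinear E F A p) (f p) _).symm
  · exact (congrArg (_ • ·) (hullVectorSection_apply α X p)).trans
      (map_smul (hullVectorLinear E F A p) _ _).symm

/-- The Lie affgebroid structure on `A` induced by a Lie algebroid structure on `Â` for which the
brackets of sections of `A` are sections of `V(A)`. -/
def inducedLieAffgebroid : LieAffgebroid E F V A where
  bracket := b
  linPart := inducedLinPart hb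
  bracket_vadd α X β := ContMDiffSection.ext fun p =>
    hullVector_injective (E := E) (F := F) (A := A) p <|
      (hullVector_bracket_vadd hb α β X _ (fun q => (hullVectorSection_apply α X q).symm) p).trans <|
        (congrArg₂ (· + ·) (hullVector_bracket_vadd_self' hb α X p) (hb α β p)).symm.trans
          (map_add (hullVectorLinear E F A p) _ _).symm
  bracket_skew := induced_bracket_skew hb
  jacobi := induced_jacobi hb
  anchor := inducedAnchor L
  contMDiff_anchor := L.contMDiff_anchor.comp (contMDiff_hullMap E F V A)
  leibniz := induced_leibniz hb

end InducedBracket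

/-- A bracket with values in V(A) carries the whole structure: the anchor, the linear parts and all
the axioms come from Â. -/
lemma exists_lieAffgebroid_iff :
    (∃ 𝒜 : LieAffgebroid E F V A, ∀ (X Y : Sec E F A) (p : M),
        hullVector E F A (𝒜.bracket X Y p) = L.bracket (hullSection X) (hullSection Y) p) ↔
      ∀ X Y : Sec E F A, ∃ Z : Sec E F V, ∀ p : M,
        hullVector E F A (Z p) = L.bracket (hullSection X) (hullSection Y) p := by
  refine ⟨fun ⟨𝒜, h⟩ X Y => ⟨𝒜.bracket X Y, h X Y⟩, fun h => ?_⟩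
  choose b hb using h
  exact ⟨inducedLieAffgebroid hb, hb⟩

lemma exists_hullVector_bracket_iff [SigmaCompactSpace M] :
    (∀ X Y : Sec E F A, ∃ Z : Sec E F V, ∀ p : M,
        hullVector E F A (Z p) = L.bracket (hullSection X) (hullSection Y) p) ↔
      ∀ X Y p, extDeriv₁ L (oneSection E F V A) X Y p = 0 := by
  rw [extDeriv₁_oneSection_eq_zero_iff]
  refine ⟨fun h α β p => ?_, fun h α β => exists_hullVector_eq _ (h α β)⟩
  obtain ⟨Z, hZ⟩ := h α β
  rw [pairing, ← hZ p]
  exact hullVector_apply_one (Z p)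

set_option synthInstance.maxHeartbeats 200000 in
/-- The tangent space of `A` in the tangent space of `Â`. -/
lemma mem_range_mfderiv_hullMap_iff (a : TotalSpace F A) (v : E × VectorHullModel F) :
    v ∈ range (mfderiv (𝓘(ℝ, E).prod 𝓘(ℝ, F)) (𝓘(ℝ, E).prod 𝓘(ℝ, VectorHullModel F))
      (hullMap E F V A) a : E × F → E × VectorHullModel F) ↔ v.2 (0, 1) = 0 := by
  -- J is the linear part of the embedding in the trivializations: x goes to (ℓ, b) ↦ ℓ x, and the
  -- constant term is (ℓ, b) ↦ b.
  let J : F →L[ℝ] VectorHullModel F :=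
    ((ContinuousLinearMap.compL ℝ (AffineDualModel F) (F →L[ℝ] ℝ) ℝ).flip
      (ContinuousLinearMap.fst ℝ (F →L[ℝ] ℝ) ℝ)) ∘L ContinuousLinearMap.apply ℝ ℝ
  have hJ : ∀ x m, J x m = m.1 x := fun _ _ => rfl
  have hd := hasMFDerivAt_of_affine_coord (E := E) (F := F) (G := VectorHullModel F)
    (A := A) (B := VectorHull E F V A) (Φ := hullMap E F V A) (fun _ => rfl) a
    (contMDiff_hullMap E F V A).continuous.continuousAt J (ContinuousLinearMap.snd ℝ (F →L[ℝ] ℝ) ℝ)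
    fun z hz => ⟨⟨hz, mem_univ _⟩, ContinuousLinearMap.ext fun m => hullPoint_coord hz z.2 m⟩
  rw [hd.mfderiv]
  constructor
  · rintro ⟨u, rfl⟩
    change J u.2 (0, 1) = 0
    rw [hJ]
    rfl
  · intro h
    -- A functional that vanishes on (0, 1) depends only on ℓ, so it is J of the point representing
    -- its restriction to the pairs (ℓ, 0).
    refine ⟨(v.1, hullModelPoint F v.2), Prod.ext rfl (ContinuousLinearMap.ext fun m => ?_)⟩
    change J (hullModelPoint F v.2) m = v.2 m
    have hm : m = (m.1, (0 : ℝ)) + m.2 • ((0, 1) : AffineDualModel F) := by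
      refine Prod.ext ?_ ?_ <;> simp
    rw [hJ, apply_hullModelPoint]
    conv_rhs => rw [hm, map_add, map_smul, h, smul_zero, add_zero]

/-- Tangency at Y(p) means that X^c annihilates ι_φ there. This derivative is ⟨L_X φ, Y⟩(p) = -⟨φ,
[X, Y]⟩(p), because ⟨φ, Y⟩ is constant. -/
lemma completeLift_tangent_iff [SigmaCompactSpace M] :
    (∀ (X : Sec E F A) (a : TotalSpace F A),
        completeLift L (hullSection X) (hullMap E F V A a) ∈
          range (mfderiv (𝓘(ℝ, E).prod 𝓘(ℝ, F)) (𝓘(ℝ, E).prod 𝓘(ℝ, VectorHullModel F))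
            (hullMap E F V A) a)) ↔
      ∀ X Y p, extDeriv₁ L (oneSection E F V A) X Y p = 0 := by
  rw [extDeriv₁_oneSection_eq_zero_iff]
  have key : ∀ (X Y : Sec E F A) (p : M), completeLift L (hullSection X)
      (hullMap E F V A ⟨p, Y p⟩) ∈ range (mfderiv (𝓘(ℝ, E).prod 𝓘(ℝ, F))
        (𝓘(ℝ, E).prod 𝓘(ℝ, VectorHullModel F)) (hullMap E F V A) ⟨p, Y p⟩) ↔
      pairing (oneSection E F V A) (L.bracket (hullSection X) (hullSection Y)) p = 0 := by
    intro X Y p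
    refine (mem_range_mfderiv_hullMap_iff ⟨p, Y p⟩ _).trans ?_
    have h := completeLift_linear L (hullSection X) (oneSection E F V A)
      (hullMap E F V A ⟨p, Y p⟩) (hullSection Y) rfl
    have h1 := differential_linearFunDual_of_coord_eventuallyEq (oneSection E F V A)
      (hullMap E F V A ⟨p, Y p⟩) (oneSection_coord_eventuallyEq p)
      (completeLift L (hullSection X) (hullMap E F V A ⟨p, Y p⟩))
    have h4 : lieDeriv₁ L (hullSection X) (oneSection E F V A) (hullSection Y) p =
        -pairing (oneSection E F V A) (L.bracket (hullSection X) (hullSection Y)) p := by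
      simp [lieDeriv₁, pairing_oneSection_hullSection]
    rw [← neg_eq_zero (a := pairing _ _ p), ← h1.symm.trans (h.trans h4)]
  -- The equivalence `key` concerns points of the form Y(p); a section through the given point
  -- covers the general case.
  refine ⟨fun h X Y p => (key X Y p).1 (h X _), fun h X a => ?_⟩
  obtain ⟨p, a⟩ := a
  obtain ⟨Y, hY⟩ := exists_affine_section_through (E := E) (F := F) (V := V) a
  obtain rfl : Y p = a := hullPoint_injective p hY
  exact (key X Y p).2 (h X Y p)

end Affgebroid

/-! ### The Lie derivative of a bivector field in local coordinates -/

section BivectorTensoriality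

variable {B H N : Type*} [NormedAddCommGroup B] [NormedSpace ℝ B] [TopologicalSpace H]
  {I : ModelWithCorners ℝ B H} [TopologicalSpace N] [ChartedSpace H N]
  {ι : Type*}

lemma mdifferentiableAt_finset_sum_and_differential {f : ι → N → ℝ} {x : N} (s : Finset ι)
    (h : ∀ i ∈ s, MDifferentiableAt I 𝓘(ℝ, ℝ) (f i) x) :
    MDifferentiableAt I 𝓘(ℝ, ℝ) (fun y => ∑ i ∈ s, f i y) x ∧
      differential I (fun y => ∑ i ∈ s, f i y) x = ∑ i ∈ s, differential I (f i) x := by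
  classical
  induction s using Finset.induction_on with
  | empty =>
    simp only [Finset.sum_empty]
    exact ⟨mdifferentiableAt_const, differential_const 0⟩
  | insert i s hi ih =>
    simp only [Finset.sum_insert hi]
    have h1 := h i (Finset.mem_insert_self i s)
    have h2 := ih fun j hj => h j (Finset.mem_insert_of_mem hj)
    exact ⟨(h1.hasMFDerivAt.add h2.1.hasMFDerivAt).mdifferentiableAt,
      (differential_add h1 h2.1).trans (congrArg _ h2.2)⟩

lemma mdifferentiableAt_finset_sum {f : ι → N → ℝ} {x : N} (s : Finset ι)
    (h : ∀ i ∈ s, MDifferentiableAt I 𝓘(ℝ, ℝ) (f i) x) :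
    MDifferentiableAt I 𝓘(ℝ, ℝ) (fun y => ∑ i ∈ s, f i y) x :=
  (mdifferentiableAt_finset_sum_and_differential s h).1

lemma differential_finset_sum {f : ι → N → ℝ} {x : N} (s : Finset ι)
    (h : ∀ i ∈ s, MDifferentiableAt I 𝓘(ℝ, ℝ) (f i) x) :
    differential I (fun y => ∑ i ∈ s, f i y) x = ∑ i ∈ s, differential I (f i) x :=
  (mdifferentiableAt_finset_sum_and_differential s h).2

lemma MDifferentiableAt.fun_mul_real {f g : N → ℝ} {x : N} (hf : MDifferentiableAt I 𝓘(ℝ, ℝ) f x)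
    (hg : MDifferentiableAt I 𝓘(ℝ, ℝ) g x) :
    MDifferentiableAt I 𝓘(ℝ, ℝ) (fun y => f y * g y) x :=
  (hf.hasMFDerivAt.mul hg.hasMFDerivAt).mdifferentiableAt

variable [Fintype ι]

/-- The differential of a function of the local coordinates. -/
lemma differential_comp_extChartAt [FiniteDimensional ℝ B] [IsManifold I ∞ N]
    (b : Module.Basis ι ℝ B) {G : B → ℝ} {w y : N} (hy : y ∈ (extChartAt I w).source)
    (hG : DifferentiableAt ℝ G (extChartAt I w y)) :
    MDifferentiableAt I 𝓘(ℝ, ℝ) (G ∘ extChartAt I w) y ∧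
    differential I (G ∘ extChartAt I w) y = ∑ i, fderiv ℝ G (extChartAt I w y) (b i) •
      differential I (LinearMap.toContinuousLinearMap (b.coord i) ∘ extChartAt I w) y := by
  have hχ : MDifferentiableAt I 𝓘(ℝ, B) (extChartAt I w) y :=
    mdifferentiableAt_extChartAt (by rwa [extChartAt_source] at hy)
  have hG' := hG.hasFDerivAt.hasMFDerivAt.comp y hχ.hasMFDerivAt
  refine ⟨hG'.mdifferentiableAt, ?_⟩
  have hε : ∀ i v, differential I (LinearMap.toContinuousLinearMap (b.coord i) ∘ extChartAt I w) y v =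
      b.repr (mfderiv I 𝓘(ℝ, B) (extChartAt I w) y v : B) i := fun i v =>
    congrArg (fun l : TangentSpace I y →L[ℝ] ℝ => l v)
      ((LinearMap.toContinuousLinearMap (b.coord i)).hasMFDerivAt.comp y hχ.hasMFDerivAt).mfderiv
  refine ContinuousLinearMap.ext fun v => ?_
  have hGv : differential I (G ∘ extChartAt I w) y v = fderiv ℝ G (extChartAt I w y)
      (mfderiv I 𝓘(ℝ, B) (extChartAt I w) y v : B) :=
    congrArg (fun l : TangentSpace I y →L[ℝ] ℝ => l v) hG'.mfderiv
  rw [hGv, sum_apply]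
  have hv := b.sum_repr (mfderiv I 𝓘(ℝ, B) (extChartAt I w) y v : B)
  conv_lhs => rw [← hv]
  rw [map_sum]
  refine Finset.sum_congr rfl fun i _ => ?_
  rw [map_smul, smul_eq_mul, mul_comm, ← hε i v]
  rfl

/-- Near `w` the differential of a smooth function is a combination of the differentials of the
local coordinates. The coefficients are the partial derivatives, so that the matrix of the
differentials of the coefficients at `w` is symmetric. -/
lemma exists_differential_eq_sum [FiniteDimensional ℝ B] [IsManifold I ∞ N] [I.Boundaryless]
    (b : Module.Basis ι ℝ B) {f : N → ℝ} (hf : ContMDiff I 𝓘(ℝ, ℝ) ∞ f) (w : N) {x : ι → N → ℝ}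
    (hx : ∀ i, x i =ᶠ[𝓝 w] LinearMap.toContinuousLinearMap (b.coord i) ∘ extChartAt I w) :
    ∃ (a : ι → N → ℝ) (h : ι → ι → ℝ),
      (∀ i, MDifferentiableAt I 𝓘(ℝ, ℝ) (a i) w) ∧
      (∀ᶠ y in 𝓝 w, differential I f y = ∑ i, a i y • differential I (x i) y) ∧
      (∀ i, differential I (a i) w = ∑ j, h i j • differential I (x j) w) ∧
      ∀ i j, h i j = h j i := by
  set χ := extChartAt I w with hχ
  let G : B → ℝ := f ∘ χ.symm
  have hG : ∀ z ∈ χ.target, ContDiffAt ℝ ∞ G z := fun z hz => by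
    rw [← contMDiffAt_iff_contDiffAt]
    exact hf.contMDiffAt.comp z ((contMDiffOn_extChartAt_symm w).contMDiffAt
      (extChartAt_target_mem_nhds' hz))
  have hsrc : χ.source ∈ 𝓝 w := extChartAt_source_mem_nhds w
  have hfG : ∀ y ∈ χ.source, f =ᶠ[𝓝 y] G ∘ χ := fun y hy => by
    filter_upwards [(isOpen_extChartAt_source w).mem_nhds hy] with z hz
    simp only [G, Function.comp_apply]
    rw [χ.left_inv hz]
  have hw : χ w ∈ χ.target := mem_extChartAt_target w
  have hdG : DifferentiableAt ℝ (fderiv ℝ G) (χ w) :=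
    ((hG _ hw).fderiv_right (m := 1) (by norm_cast)).differentiableAt one_ne_zero
  have hdGi : ∀ i, HasFDerivAt (fun z => fderiv ℝ G z (b i))
      ((ContinuousLinearMap.apply ℝ ℝ (b i)).comp (fderiv ℝ (fderiv ℝ G) (χ w))) (χ w) := fun i =>
    (ContinuousLinearMap.apply ℝ ℝ (b i)).hasFDerivAt.comp _ hdG.hasFDerivAt
  -- Functions with the same germ at w have the same germ, hence the same differential, at all
  -- points near w.
  have hx' : ∀ᶠ y in 𝓝 w, ∀ i, differential I (x i) y =
      differential I (LinearMap.toContinuousLinearMap (b.coord i) ∘ χ) y := by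
    refine Filter.eventually_all.2 fun i => ?_
    filter_upwards [(hx i).eventuallyEq_nhds] with y hy using differential_congr hy
  refine ⟨fun i => (fun z => fderiv ℝ G z (b i)) ∘ χ,
    fun i j => fderiv ℝ (fderiv ℝ G) (χ w) (b j) (b i), fun i => ?_, ?_, fun i => ?_, fun i j => ?_⟩
  · exact (differential_comp_extChartAt b (mem_extChartAt_source w)
      (hdGi i).differentiableAt).1
  · filter_upwards [hsrc, hx'] with y hy hxy
    simp only [hxy]
    rw [differential_congr (hfG y hy)]
    exact (differential_comp_extChartAt b hy
      ((hG _ (χ.map_source hy)).differentiableAt (by simp))).2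
  · simp only [hx'.self_of_nhds]
    refine (differential_comp_extChartAt b (mem_extChartAt_source w)
      (hdGi i).differentiableAt).2.trans ?_
    rw [← hχ, (hdGi i).fderiv]
    rfl
  -- Symmetry of the second derivative of f in the chart.
  · exact ((hG _ hw).isSymmSndFDerivAt (by rw [minSmoothness_of_isRCLikeNormedField]; norm_cast))
      (b j) (b i)

/-- The Lie derivative of a bivector field along a vector field with locally constant components
vanishes if the derivatives of the components of the bivector field do. -/
lemma lieDerivBivector_eq_zero_of_coordinates [FiniteDimensional ℝ B] [IsManifold I ∞ N]
    [I.Boundaryless] (b : Module.Basis ι ℝ B) (ζ : ∀ y : N, TangentSpace I y)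
    (Λ : ∀ y : N, Cotangent I y →ₗ[ℝ] Cotangent I y →ₗ[ℝ] ℝ) (w : N) {x : ι → N → ℝ}
    (hx : ∀ i, x i =ᶠ[𝓝 w] LinearMap.toContinuousLinearMap (b.coord i) ∘ extChartAt I w)
    (c : ι → ℝ) (hζ : ∀ i, ∀ᶠ y in 𝓝 w, differential I (x i) y (ζ y) = c i)
    (hΛ : ∀ i j, MDifferentiableAt I 𝓘(ℝ, ℝ)
      (fun y => Λ y (differential I (x i) y) (differential I (x j) y)) w)
    (hΛ' : ∀ i j, differential I
      (fun y => Λ y (differential I (x i) y) (differential I (x j) y)) w (ζ w) = 0)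
    {f g : N → ℝ} (hf : ContMDiff I 𝓘(ℝ, ℝ) ∞ f) (hg : ContMDiff I 𝓘(ℝ, ℝ) ∞ g) :
    lieDerivBivector I ζ Λ f g w = 0 := by
  -- This is d(ζ f) = ∑ ζ(a_i) dx_i at w. Near w, ζ f = ∑ a_i c_i with constant c_i, so d(ζ f) = ∑
  -- c_i h_ij dx_j; the symmetry of h identifies ∑ c_i h_ij with ζ(a_j).
  have hd : ∀ {f : N → ℝ} {a : ι → N → ℝ} {h : ι → ι → ℝ},
      (∀ i, MDifferentiableAt I 𝓘(ℝ, ℝ) (a i) w) →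
      (∀ᶠ y in 𝓝 w, differential I f y = ∑ i, a i y • differential I (x i) y) →
      (∀ i, differential I (a i) w = ∑ j, h i j • differential I (x j) w) →
      (∀ i j, h i j = h j i) →
      differential I (fun y => differential I f y (ζ y)) w =
        ∑ i, differential I (a i) w (ζ w) • differential I (x i) w := by
    intro f a h ha hfa hda hh
    have h1 : (fun y => differential I f y (ζ y)) =ᶠ[𝓝 w] fun y => ∑ i, a i y * c i := by
      filter_upwards [hfa, Filter.eventually_all.2 hζ] with y hy hζy
      rw [hy, sum_apply]
      exact Finset.sum_congr rfl fun i _ => congrArg (a i y * ·) (hζy i)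
    have hc : ∀ i, MDifferentiableAt I 𝓘(ℝ, ℝ) (fun _ : N => c i) w := fun i => mdifferentiableAt_const
    have h2 : ∀ i, differential I (fun y => a i y * c i) w = c i • differential I (a i) w := by
      intro i
      refine ContinuousLinearMap.ext fun v => ?_
      rw [differential_mul (ha i) (hc i), differential_const]
      exact (congrArg (· + _) (mul_zero _)).trans (zero_add _)
    have h3 : ∀ i, differential I (a i) w (ζ w) = ∑ j, h i j * c j := fun i => by
      rw [hda i, sum_apply]
      exact Finset.sum_congr rfl fun j _ => congrArg (h i j * ·) (hζ j).self_of_nhds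
    rw [differential_congr h1, differential_finset_sum _ fun i _ => (ha i).fun_mul_real (hc i)]
    simp only [h2, h3]
    simp only [hda, Finset.smul_sum, Finset.sum_smul, smul_smul]
    rw [Finset.sum_comm]
    refine Finset.sum_congr rfl fun i _ => Finset.sum_congr rfl fun j _ => ?_
    rw [hh i j, mul_comm]
  obtain ⟨a, h, ha, hfa, hda, hh⟩ := exists_differential_eq_sum b hf w hx
  obtain ⟨a', h', ha', hga, hda', hh'⟩ := exists_differential_eq_sum b hg w hx
  set Q : ι → ι → N → ℝ := fun i j y => Λ y (differential I (x i) y) (differential I (x j) y)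
    with hQ
  have hΛfg : (fun y => Λ y (differential I f y) (differential I g y)) =ᶠ[𝓝 w]
      fun y => ∑ i, ∑ j, a i y * (a' j y * Q i j y) := by
    filter_upwards [hfa, hga] with y hy hy'
    rw [hy, hy']
    simp only [map_sum, map_smul, LinearMap.sum_apply, LinearMap.smul_apply, smul_eq_mul,
      Finset.mul_sum, hQ]
    rw [Finset.sum_comm]
    refine Finset.sum_congr rfl fun i _ => Finset.sum_congr rfl fun j _ => ?_
    ring
  have hij : ∀ i j, MDifferentiableAt I 𝓘(ℝ, ℝ) (fun y => a i y * (a' j y * Q i j y)) w :=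
    fun i j => (ha i).fun_mul_real ((ha' j).fun_mul_real (hΛ i j))
  -- The product rule gives three kinds of terms. Those with ζ(Q_ij) vanish by hypothesis; the other
  -- two are exactly Λ(d(ζ f), dg) and Λ(df, d(ζ g)).
  have hmain : differential I (fun y => Λ y (differential I f y) (differential I g y)) w (ζ w) =
      ∑ i, ∑ j, (differential I (a i) w (ζ w) * (a' j w * Q i j w) +
        a i w * (differential I (a' j) w (ζ w) * Q i j w)) := by
    rw [differential_congr hΛfg, differential_finset_sum _ fun i _ =>
      mdifferentiableAt_finset_sum Finset.univ fun j _ => hij i j, sum_apply]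
    refine Finset.sum_congr rfl fun i _ => ?_
    rw [differential_finset_sum _ fun j _ => hij i j, sum_apply]
    refine Finset.sum_congr rfl fun j _ => ?_
    rw [differential_mul (ha i) ((ha' j).fun_mul_real (hΛ i j)),
      differential_mul (ha' j) (hΛ i j), hΛ' i j]
    ring
  rw [lieDerivBivector, hmain, hd ha hfa hda hh, hd ha' hga hda' hh', hfa.self_of_nhds,
    hga.self_of_nhds]
  simp only [map_sum, map_smul, LinearMap.sum_apply, LinearMap.smul_apply, smul_eq_mul,
    Finset.mul_sum, Finset.sum_add_distrib]
  have e1 : ∑ i, ∑ j, differential I (a i) w (ζ w) * (a' j w * Q i j w) =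
      ∑ j, ∑ i, a' j w * (differential I (a i) w (ζ w) *
        Λ w (differential I (x i) w) (differential I (x j) w)) := by
    rw [Finset.sum_comm]
    refine Finset.sum_congr rfl fun i _ => Finset.sum_congr rfl fun j _ => ?_
    simp only [hQ]
    ring
  have e2 : ∑ i, ∑ j, a i w * (differential I (a' j) w (ζ w) * Q i j w) =
      ∑ j, ∑ i, differential I (a' j) w (ζ w) * (a i w *
        Λ w (differential I (x i) w) (differential I (x j) w)) := by
    rw [Finset.sum_comm]
    refine Finset.sum_congr rfl fun i _ => Finset.sum_congr rfl fun j _ => ?_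
    simp only [hQ]
    ring
  rw [e1, e2]
  ring

end BivectorTensoriality

/-! ### Vertical lifts and the linear Poisson tensor -/

section VerticalLift

variable {E : Type*} [NormedAddCommGroup E] [NormedSpace ℝ E] [FiniteDimensional ℝ E]
  {M : Type*} [TopologicalSpace M] [ChartedSpace E M] [IsManifold 𝓘(ℝ, E) ∞ M] [T2Space M]
  {F : Type*} [NormedAddCommGroup F] [NormedSpace ℝ F] [FiniteDimensional ℝ F]
  {W : M → Type*} [∀ p, AddCommGroup (W p)] [∀ p, Module ℝ (W p)]
  [∀ p, TopologicalSpace (W p)] [TopologicalSpace (TotalSpace F W)]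
  [FiberBundle F W] [VectorBundle ℝ F W] [ContMDiffVectorBundle ∞ F W 𝓘(ℝ, E)]

/-- In a trivialization the curve is affine in t. Its differentiability makes the derivative that
defines the vertical lift a true velocity rather than the default value 0. -/
lemma mdifferentiableAt_fiber_line (w : TotalSpace F W) (v : W w.1) :
    MDifferentiableAt 𝓘(ℝ, ℝ) (𝓘(ℝ, E).prod 𝓘(ℝ, F))
      (fun t : ℝ => (⟨w.1, w.2 + t • v⟩ : TotalSpace F W)) 0 := by
  have h : ContMDiffAt 𝓘(ℝ, ℝ) (𝓘(ℝ, E).prod 𝓘(ℝ, F)) ∞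
      (fun t : ℝ => (⟨w.1, w.2 + t • v⟩ : TotalSpace F W)) 0 := by
    rw [contMDiffAt_totalSpace]
    refine ⟨contMDiffAt_const, ?_⟩
    have hlin := (trivializationAt F W w.1).linear ℝ (mem_baseSet_trivializationAt F W w.1)
    have h1 : (fun t : ℝ => (trivializationAt F W w.1 ⟨w.1, w.2 + t • v⟩).2) = fun t : ℝ =>
        (trivializationAt F W w.1 ⟨w.1, w.2⟩).2 + t • (trivializationAt F W w.1 ⟨w.1, v⟩).2 := by
      funext t
      rw [hlin.map_add, hlin.map_smul]
    change ContMDiffAt 𝓘(ℝ, ℝ) 𝓘(ℝ, F) ∞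
      (fun t : ℝ => (trivializationAt F W w.1 ⟨w.1, w.2 + t • v⟩).2) 0
    rw [h1, contMDiffAt_iff_contDiffAt]
    fun_prop
  exact h.mdifferentiableAt (by simp)

/-- The vertical lift is the derivative along the lines `w + t μ`. -/
lemma differential_verticalLift (μ : Sec E F W) (w : TotalSpace F W) {f : TotalSpace F W → ℝ}
    (hf : MDifferentiableAt (𝓘(ℝ, E).prod 𝓘(ℝ, F)) 𝓘(ℝ, ℝ) f w) {f' : ℝ}
    (hf' : HasDerivAt (fun t : ℝ => f ⟨w.1, w.2 + t • μ w.1⟩) f' 0) :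
    differential (𝓘(ℝ, E).prod 𝓘(ℝ, F)) f w (verticalLift μ w) = f' := by
  set c : ℝ → TotalSpace F W := fun t => ⟨w.1, w.2 + t • μ w.1⟩ with hc
  have h0 : c 0 = w := by
    simp only [hc, zero_smul, add_zero]
  have hcd := mdifferentiableAt_fiber_line (E := E) w (μ w.1)
  have hf0 : HasMFDerivAt (𝓘(ℝ, E).prod 𝓘(ℝ, F)) 𝓘(ℝ, ℝ) f (c 0)
      (differential (𝓘(ℝ, E).prod 𝓘(ℝ, F)) f w : E × F →L[ℝ] ℝ) := by
    have := hf.hasMFDerivAt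
    rw [h0]
    exact this
  have h1 := hf0.comp (0 : ℝ) hcd.hasMFDerivAt
  have h2 : HasFDerivAt (f ∘ c) ((differential (𝓘(ℝ, E).prod 𝓘(ℝ, F)) f w : E × F →L[ℝ] ℝ).comp
      (mfderiv 𝓘(ℝ, ℝ) (𝓘(ℝ, E).prod 𝓘(ℝ, F)) c 0 : ℝ →L[ℝ] E × F)) (0 : ℝ) :=
    hasMFDerivAt_iff_hasFDerivAt.1 h1
  exact h2.hasDerivAt.unique hf'

lemma contMDiff_linearFun (X : Sec E (F →L[ℝ] ℝ) (DualBundle W)) :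
    ContMDiff (𝓘(ℝ, E).prod 𝓘(ℝ, F)) 𝓘(ℝ, ℝ) ∞ (linearFun X) := by
  intro w
  have hid : ContMDiffAt (𝓘(ℝ, E).prod 𝓘(ℝ, F)) (𝓘(ℝ, E).prod 𝓘(ℝ, F)) ∞
    (id : TotalSpace F W → TotalSpace F W) w := contMDiffAt_id
  rw [contMDiffAt_totalSpace] at hid
  have hX := ((contMDiffAt_section (n := ∞) w.1).1 (X.contMDiff w.1)).comp w hid.1
  refine (hX.clm_apply hid.2).congr_of_eventuallyEq ?_
  have : π F W ⁻¹' (trivializationAt F W w.1).baseSet ∈ 𝓝 w :=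
    (FiberBundle.continuous_proj F W).continuousAt.preimage_mem_nhds
      ((trivializationAt F W w.1).open_baseSet.mem_nhds (mem_baseSet_trivializationAt F W w.1))
  filter_upwards [this] with z hz using dual_apply_eq hz _ _

lemma mdifferentiableAt_linearFun (X : Sec E (F →L[ℝ] ℝ) (DualBundle W)) (w : TotalSpace F W) :
    MDifferentiableAt (𝓘(ℝ, E).prod 𝓘(ℝ, F)) 𝓘(ℝ, ℝ) (linearFun X) w :=
  (contMDiff_linearFun X).mdifferentiable (by simp) w

lemma mdifferentiableAt_comp_proj {f : M → ℝ} (hf : ContMDiff 𝓘(ℝ, E) 𝓘(ℝ, ℝ) ∞ f)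
    (w : TotalSpace F W) :
    MDifferentiableAt (𝓘(ℝ, E).prod 𝓘(ℝ, F)) 𝓘(ℝ, ℝ) (f ∘ π F W) w :=
  (hf.comp (contMDiff_proj W)).mdifferentiable (by simp) w

/-- Along the line w + t μ the function ι_X is affine in t, with slope ⟨μ, X⟩. -/
lemma differential_linearFun_verticalLift (μ : Sec E F W) (X : Sec E (F →L[ℝ] ℝ) (DualBundle W))
    (w : TotalSpace F W) :
    differential (𝓘(ℝ, E).prod 𝓘(ℝ, F)) (linearFun X) w (verticalLift μ w) =
      pairing μ X w.1 := by
  refine differential_verticalLift μ w (mdifferentiableAt_linearFun X w) ?_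
  have h : (fun t : ℝ => linearFun X (⟨w.1, w.2 + t • μ w.1⟩ : TotalSpace F W)) =
      fun t : ℝ => linearFun X w + t * pairing μ X w.1 := by
    funext t
    change (X w.1 (w.2 + t • μ w.1) : ℝ) = (X w.1 w.2 : ℝ) + t * (X w.1 (μ w.1) : ℝ)
    rw [map_add, map_smul]
    rfl
  rw [h]
  simpa using ((hasDerivAt_id (0 : ℝ)).mul_const (pairing μ X w.1)).const_add (linearFun X w)

lemma differential_comp_proj_verticalLift (μ : Sec E F W) {f : M → ℝ}
    (hf : ContMDiff 𝓘(ℝ, E) 𝓘(ℝ, ℝ) ∞ f) (w : TotalSpace F W) :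
    differential (𝓘(ℝ, E).prod 𝓘(ℝ, F)) (f ∘ π F W) w (verticalLift μ w) = 0 :=
  differential_verticalLift μ w (mdifferentiableAt_comp_proj hf w) 
    (hasDerivAt_const (0 : ℝ) (f w.1))

variable (L : LieAlgebroid E (F →L[ℝ] ℝ) (DualBundle W))

lemma isLinearPoissonAt_linearPoissonTensor (w : TotalSpace F W) :
    IsLinearPoissonAt L w (linearPoissonTensor L w) :=
  (existsUnique_isLinearPoissonAt L w).choose_spec.1

lemma IsLinearPoissonAt.skew {w : TotalSpace F W}
    {Λ : Cotangent (𝓘(ℝ, E).prod 𝓘(ℝ, F)) w →ₗ[ℝ] Cotangent (𝓘(ℝ, E).prod 𝓘(ℝ, F)) w →ₗ[ℝ] ℝ}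
    (h : IsLinearPoissonAt L w Λ) (ξ η : Cotangent (𝓘(ℝ, E).prod 𝓘(ℝ, F)) w) :
    Λ ξ η = -Λ η ξ := by
  have h1 := h.alternating (ξ + η)
  simp only [map_add, LinearMap.add_apply, h.alternating, zero_add, add_zero] at h1
  linarith

/-- The Lie derivative of the linear Poisson tensor along the vertical lift of `μ`, evaluated on
linear functions, is `-dμ`. -/
lemma lieDerivBivector_verticalLift_linearFun (μ : Sec E F W)
    (X Y : Sec E (F →L[ℝ] ℝ) (DualBundle W)) (w : TotalSpace F W) :
    lieDerivBivector (𝓘(ℝ, E).prod 𝓘(ℝ, F)) (verticalLift μ) (linearPoissonTensor L)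
      (linearFun X) (linearFun Y) w = -extDeriv₁ L μ X Y w.1 := by
  have hΛ := isLinearPoissonAt_linearPoissonTensor L
  have h1 : (fun y => linearPoissonTensor L y
      (differential (𝓘(ℝ, E).prod 𝓘(ℝ, F)) (linearFun X) y)
      (differential (𝓘(ℝ, E).prod 𝓘(ℝ, F)) (linearFun Y) y)) = linearFun (L.bracket X Y) :=
    funext fun y => (hΛ y).linear_linear X Y
  have h2 : ∀ X : Sec E (F →L[ℝ] ℝ) (DualBundle W),
      (fun y => differential (𝓘(ℝ, E).prod 𝓘(ℝ, F)) (linearFun X) y (verticalLift μ y)) =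
        smoothPairing μ X ∘ π F W :=
    fun X => funext fun y => differential_linearFun_verticalLift μ X y
  -- The vertical lift turns a linear function into a basic one, so each of the three terms is given
  -- by a defining identity of Λ: they are ⟨μ, [X, Y]⟩, ρ(Y)⟨μ, X⟩ and -ρ(X)⟨μ, Y⟩.
  rw [lieDerivBivector, h1, h2, h2, differential_linearFun_verticalLift, (hΛ w).skew L,
    (hΛ w).linear_basic, (hΛ w).linear_basic, extDeriv₁]
  change _ - -(differential 𝓘(ℝ, E) (pairing μ X) w.1 _) -
    differential 𝓘(ℝ, E) (pairing μ Y) w.1 _ = _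
  ring

/-- The derivative of a smooth function along the anchor of a section is differentiable. -/
lemma contMDiff_differential_anchor (X : Sec E (F →L[ℝ] ℝ) (DualBundle W))
    (f : C^∞⟮𝓘(ℝ, E), M; ℝ⟯) :
    ContMDiff 𝓘(ℝ, E) 𝓘(ℝ, ℝ) ∞ (fun q => differential 𝓘(ℝ, E) f q (L.anchor q (X q))) := by
  -- The function is the fibre component of the tangent map of f applied to the vector field ρ(X).
  have h1 := L.contMDiff_anchor.comp X.contMDiff
  have h2 := f.contMDiff.contMDiff_tangentMap (m := ∞) (by norm_cast)
  exact (contMDiff_snd_tangentBundle_modelSpace ℝ 𝓘(ℝ, ℝ)).comp (h2.comp h1)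

/-- A bump function makes a chart coordinate of M, restricted to a neighbourhood of p, the germ of a
global smooth function. The identities defining Λ speak of global functions and sections only. -/
lemma exists_eventuallyEq_extChartAt (p : M) (h : E →L[ℝ] ℝ) :
    ∃ f : C^∞⟮𝓘(ℝ, E), M; ℝ⟯, ∀ᶠ q in 𝓝 p, f q = h (extChartAt 𝓘(ℝ, E) p q) := by
  obtain ⟨b, hb1, hb⟩ := exists_bump (E := E) p (chartAt E p).source (chart_source_mem_nhds E p)
  have hs : ContMDiff 𝓘(ℝ, E) 𝓘(ℝ, ℝ) ∞ (fun q => b q * h (extChartAt 𝓘(ℝ, E) p q)) := by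
    refine contMDiff_of_tsupport fun q hq => ?_
    have hq' := hb (tsupport_mul_subset_left hq)
    exact b.contMDiff.contMDiffAt.mul (h.contMDiff.contMDiffAt.comp q (contMDiffAt_extChartAt' hq'))
  refine ⟨⟨_, hs⟩, ?_⟩
  filter_upwards [hb1] with q hq
  change b q * h (extChartAt 𝓘(ℝ, E) p q) = _
  rw [hq, Pi.one_apply, one_mul]

/-! ### Chart coordinates on W as sums of linear and basic functions -/

section Coordinates

variable (X Y : Sec E (F →L[ℝ] ℝ) (DualBundle W)) (f g : C^∞⟮𝓘(ℝ, E), M; ℝ⟯)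

/-- The sum of a linear and a basic function on `W`. -/
def affineFun (w : TotalSpace F W) : ℝ := linearFun X w + f w.1

lemma differential_affineFun (w : TotalSpace F W) :
    differential (𝓘(ℝ, E).prod 𝓘(ℝ, F)) (affineFun X f) w =
      differential (𝓘(ℝ, E).prod 𝓘(ℝ, F)) (linearFun X) w +
        differential (𝓘(ℝ, E).prod 𝓘(ℝ, F)) (f ∘ π F W) w :=
  differential_add (mdifferentiableAt_linearFun X w) (mdifferentiableAt_comp_proj f.contMDiff w)

/-- The tensor Λ is chosen separately at each point, so the regularity of its components is read off
from this formula. The bracket of two such functions is again linear plus basic, and only its linear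
part ι_[X,Y] is seen by a vertical lift. -/
lemma linearPoissonTensor_affineFun :
    (fun w => linearPoissonTensor L w
      (differential (𝓘(ℝ, E).prod 𝓘(ℝ, F)) (affineFun X f) w)
      (differential (𝓘(ℝ, E).prod 𝓘(ℝ, F)) (affineFun Y g) w)) = fun w : TotalSpace F W =>
    linearFun (L.bracket X Y) w + (((fun q => differential 𝓘(ℝ, E) g q (L.anchor q (X q)) +
      (-1) * differential 𝓘(ℝ, E) f q (L.anchor q (Y q))) ∘ π F W) w) := by
  funext w
  have hΛ := isLinearPoissonAt_linearPoissonTensor L w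
  rw [differential_affineFun, differential_affineFun]
  simp only [map_add, LinearMap.add_apply]
  rw [hΛ.linear_linear, hΛ.linear_basic, hΛ.basic_basic,
    hΛ.skew L (differential (𝓘(ℝ, E).prod 𝓘(ℝ, F)) (f ∘ π F W) w), hΛ.linear_basic]
  simp only [Function.comp_apply]
  ring

lemma contMDiff_bracket_affineFun_basic :
    ContMDiff 𝓘(ℝ, E) 𝓘(ℝ, ℝ) ∞ (fun q => differential 𝓘(ℝ, E) g q (L.anchor q (X q)) +
      (-1) * differential 𝓘(ℝ, E) f q (L.anchor q (Y q))) :=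
  (contMDiff_differential_anchor L X g).add
    (contMDiff_const.mul (contMDiff_differential_anchor L Y f))

lemma mdifferentiableAt_linearPoissonTensor_affineFun (w : TotalSpace F W) :
    MDifferentiableAt (𝓘(ℝ, E).prod 𝓘(ℝ, F)) 𝓘(ℝ, ℝ) (fun w => linearPoissonTensor L w
      (differential (𝓘(ℝ, E).prod 𝓘(ℝ, F)) (affineFun X f) w)
      (differential (𝓘(ℝ, E).prod 𝓘(ℝ, F)) (affineFun Y g) w)) w := by
  rw [linearPoissonTensor_affineFun]
  exact ((mdifferentiableAt_linearFun _ w).hasMFDerivAt.add (mdifferentiableAt_comp_proj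
    (contMDiff_bracket_affineFun_basic L X Y f g) w).hasMFDerivAt).mdifferentiableAt

lemma differential_affineFun_verticalLift (μ : Sec E F W) (w : TotalSpace F W) :
    differential (𝓘(ℝ, E).prod 𝓘(ℝ, F)) (affineFun X f) w (verticalLift μ w) =
      pairing μ X w.1 := by
  rw [differential_affineFun, _root_.add_apply, differential_linearFun_verticalLift,
    differential_comp_proj_verticalLift μ f.contMDiff, add_zero]

lemma differential_linearPoissonTensor_affineFun_verticalLift (μ : Sec E F W)
    (w : TotalSpace F W) :
    differential (𝓘(ℝ, E).prod 𝓘(ℝ, F)) (fun w => linearPoissonTensor L w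
      (differential (𝓘(ℝ, E).prod 𝓘(ℝ, F)) (affineFun X f) w)
      (differential (𝓘(ℝ, E).prod 𝓘(ℝ, F)) (affineFun Y g) w)) w (verticalLift μ w) =
      pairing μ (L.bracket X Y) w.1 := by
  rw [linearPoissonTensor_affineFun, differential_add (mdifferentiableAt_linearFun _ w)
    (mdifferentiableAt_comp_proj (contMDiff_bracket_affineFun_basic L X Y f g) w),
    _root_.add_apply, differential_linearFun_verticalLift]
  have h := differential_comp_proj_verticalLift μ (contMDiff_bracket_affineFun_basic L X Y f g) w
  exact (congrArg (_ + ·) h).trans (add_zero _)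

/-- A linear coordinate near `w` is the sum of a linear and a basic function. -/
lemma exists_affineFun_eventuallyEq (w : TotalSpace F W) (ξ : E × F →L[ℝ] ℝ) :
    ∃ (X : Sec E (F →L[ℝ] ℝ) (DualBundle W)) (f : C^∞⟮𝓘(ℝ, E), M; ℝ⟯),
      affineFun X f =ᶠ[𝓝 w] ξ ∘ extChartAt (𝓘(ℝ, E).prod 𝓘(ℝ, F)) w ∧
      ∀ᶠ q in 𝓝 w.1, X.coord w.1 q = ξ ∘L ContinuousLinearMap.inr ℝ E F := by
  obtain ⟨S, hS, -⟩ := exists_frame (E := E) (F := F →L[ℝ] ℝ) (V := DualBundle W) w.1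
  obtain ⟨f, hf⟩ := exists_eventuallyEq_extChartAt w.1 (ξ ∘L ContinuousLinearMap.inl ℝ E F)
  -- Split ξ: its fibre part is the linear function of a section with constant coordinates near the
  -- base point, and its base part is a coordinate of M.
  refine ⟨S (ξ ∘L ContinuousLinearMap.inr ℝ E F), f, ?_, hS _⟩
  have hc : Filter.Tendsto (π F W) (𝓝 w) (𝓝 w.1) :=
    (FiberBundle.continuous_proj F W).continuousAt
  filter_upwards [hc.eventually (hS (ξ ∘L ContinuousLinearMap.inr ℝ E F)), hc.eventually hf,
    hc.eventually ((trivializationAt F W w.1).open_baseSet.mem_nhds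
      (mem_baseSet_trivializationAt F W w.1))] with z hz1 hz2 hz3
  have h1 : linearFun (S (ξ ∘L ContinuousLinearMap.inr ℝ E F)) z =
      ξ (0, (trivializationAt F W w.1 z).2) :=
    (dual_apply_eq hz3 _ _).trans (congrArg (fun γ : F →L[ℝ] ℝ =>
      γ (trivializationAt F W w.1 z).2) hz1)
  have h2 : f z.1 = ξ (extChartAt 𝓘(ℝ, E) w.1 z.1, 0) := hz2
  have h3 : extChartAt (𝓘(ℝ, E).prod 𝓘(ℝ, F)) w z =
      (extChartAt 𝓘(ℝ, E) w.1 z.1, (trivializationAt F W w.1 z).2) := by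
    rw [FiberBundle.extChartAt]
    refine Prod.ext ?_ rfl
    change extChartAt 𝓘(ℝ, E) w.1 (trivializationAt F W w.1 z).1 = _
    rw [Trivialization.coe_fst' _ hz3]
  rw [affineFun, h1, h2, Function.comp_apply, h3, ← map_add]
  simp

end Coordinates

/-- If a 1-form `μ` with locally constant coordinates is closed, then its vertical lift preserves
the linear Poisson tensor. -/
theorem lieDerivBivector_verticalLift_eq_zero (μ : Sec E F W) (w : TotalSpace F W) {c : F}
    (hμ : ∀ᶠ q in 𝓝 w.1, μ.coord w.1 q = c) (hd : ∀ X Y p, extDeriv₁ L μ X Y p = 0)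
    {f g : TotalSpace F W → ℝ} (hf : ContMDiff (𝓘(ℝ, E).prod 𝓘(ℝ, F)) 𝓘(ℝ, ℝ) ∞ f)
    (hg : ContMDiff (𝓘(ℝ, E).prod 𝓘(ℝ, F)) 𝓘(ℝ, ℝ) ∞ g) :
    lieDerivBivector (𝓘(ℝ, E).prod 𝓘(ℝ, F)) (verticalLift μ) (linearPoissonTensor L) f g w = 0 := by
  let b := Module.finBasis ℝ (E × F)
  choose X k hk hX using fun i => exists_affineFun_eventuallyEq w
    (LinearMap.toContinuousLinearMap (b.coord i))
  -- Both μ and X_i have locally constant coordinates, so their pairing is locally constant. It is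
  -- the i-th component of the vertical lift of μ, whose coordinate vector is (0, c).
  have hpair : ∀ i, ∀ᶠ q in 𝓝 w.1, pairing μ (X i) q = b.coord i (0, c) := fun i => by
    filter_upwards [hX i, hμ, (trivializationAt F W w.1).open_baseSet.mem_nhds
      (mem_baseSet_trivializationAt F W w.1)] with q h1 h2 hq
    refine (dual_apply_eq hq _ _).trans ?_
    exact congrArg₂ (fun (γ : F →L[ℝ] ℝ) v => γ v) h1 h2
  have hdp : ∀ i, differential 𝓘(ℝ, E) (pairing μ (X i)) w.1 = 0 := fun i =>
    (differential_congr (hpair i)).trans (differential_const _)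
  have hc : Filter.Tendsto (π F W) (𝓝 w) (𝓝 w.1) :=
    (FiberBundle.continuous_proj F W).continuousAt
  refine lieDerivBivector_eq_zero_of_coordinates b (verticalLift μ) (linearPoissonTensor L) w
    (x := fun i => affineFun (X i) (k i)) hk (fun i => b.coord i (0, c)) (fun i => ?_)
    (fun i j => mdifferentiableAt_linearPoissonTensor_affineFun L (X i) (X j) (k i) (k j) w)
    (fun i j => ?_) hf hg
  · filter_upwards [hc.eventually (hpair i)] with y hy
    rw [differential_affineFun_verticalLift]
    exact hy
  -- With the pairings locally constant, dμ(X_i, X_j) at the base point is -⟨μ, [X_i, X_j]⟩, which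
  -- is minus the derivative to be shown zero.
  · rw [differential_linearPoissonTensor_affineFun_verticalLift]
    have h := hd (X i) (X j) w.1
    rw [extDeriv₁, hdp, hdp] at h
    simpa using h

end VerticalLift

end

theorem theorem11
    {E : Type*} [NormedAddCommGroup E] [NormedSpace ℝ E] [FiniteDimensional ℝ E]
    {M : Type*} [TopologicalSpace M] [ChartedSpace E M] [IsManifold 𝓘(ℝ, E) ∞ M]
    [T2Space M] [SigmaCompactSpace M]
    {F : Type*} [NormedAddCommGroup F] [NormedSpace ℝ F] [FiniteDimensional ℝ F]
    {V : M → Type*} [∀ p, AddCommGroup (V p)] [∀ p, Module ℝ (V p)]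
    [∀ p, TopologicalSpace (V p)] [TopologicalSpace (TotalSpace F V)]
    [FiberBundle F V] [VectorBundle ℝ F V] [ContMDiffVectorBundle ∞ F V 𝓘(ℝ, E)]
    {A : M → Type*} [∀ p, AddTorsor (V p) (A p)]
    [∀ p, TopologicalSpace (A p)] [TopologicalSpace (TotalSpace F A)]
    [FiberBundle F A] [SmoothAffineBundle E F V A]
    (L : LieAlgebroid E (VectorHullModel F) (VectorHull E F V A)) :
    List.TFAE [
      ∃ 𝒜 : LieAffgebroid E F V A, ∀ (X Y : Sec E F A) (p : M),
        hullVector E F A (𝒜.bracket X Y p) = L.bracket (hullSection X) (hullSection Y) p,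
      ∀ X Y : Sec E F A, ∃ Z : Sec E F V, ∀ p : M,
        hullVector E F A (Z p) = L.bracket (hullSection X) (hullSection Y) p,
      ∀ (X Y : Sec E (VectorHullModel F) (VectorHull E F V A)) (p : M),
        extDeriv₁ L (oneSection E F V A) X Y p = 0,
      ∀ (f g : C^∞⟮𝓘(ℝ, E).prod 𝓘(ℝ, AffineDualModel F),
          TotalSpace (AffineDualModel F) (AffineDual E F V A); ℝ⟯)
        (w : TotalSpace (AffineDualModel F) (AffineDual E F V A)),
        lieDerivBivector (𝓘(ℝ, E).prod 𝓘(ℝ, AffineDualModel F))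
          (verticalLift (oneSection E F V A)) (linearPoissonTensor L) f g w = 0,
      ∀ (X : Sec E F A) (a : TotalSpace F A),
        completeLift L (hullSection X) (hullMap E F V A a) ∈
          range (mfderiv (𝓘(ℝ, E).prod 𝓘(ℝ, F)) (𝓘(ℝ, E).prod 𝓘(ℝ, VectorHullModel F))
            (hullMap E F V A) a)] := by
  tfae_have 1 ↔ 2 := exists_lieAffgebroid_iff L
  tfae_have 2 ↔ 3 := exists_hullVector_bracket_iff L
  tfae_have 5 ↔ 3 := completeLift_tangent_iff L
  tfae_have 3 → 4 := fun h f g w => lieDerivBivector_verticalLift_eq_zero L (oneSection E F V A) w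
    (oneSection_coord_eventuallyEq w.1) h f.contMDiff g.contMDiff
  tfae_have 4 → 3 := fun h X Y p => by
    -- On linear functions the Lie derivative is constant along each fibre, so any point over p
    -- would serve; the zero covector is taken.
    have h1 := h ⟨linearFun X, contMDiff_linearFun X⟩ ⟨linearFun Y, contMDiff_linearFun Y⟩ ⟨p, 0⟩
    exact neg_eq_zero.1 ((lieDerivBivector_verticalLift_linearFun L (oneSection E F V A) X Y
      ⟨p, 0⟩).symm.trans h1)
  tfae_finish
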